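/- Let $G$ be a finite-dimensional real Lie group with identity $e$ and Lie algebra $\mathfrak g=T_eG$, whose Lie exponential map $\exp:\mathfrak g\to G$ is surjective; fix for every $g\in G$ a logarithm $\log g\in\mathfrak g$, i.e. an element with $\exp(\log g)=g$, and let $\ell_g(t)=\exp(t\log g)$, $t\in[0,1]$, be the corresponding exponential path from $e$ to $g$. For a Lie group $K$ let $PK$ be the set of continuous paths $\gamma:[0,1]\to K$ for which there is a partition $0=t_0<\dots<t_n=1$ such that on each $(t_i,t_{i+1})$ the path is continuously differentiable and either regular ($\gamma'_t\neq0$ throughout) or constant, and such that $\gamma'$, viewed in the Lie algebra $\mathfrak k$ of $K$ by left translation, has one-sided limits at the points $t_i$. Let $PK_e=\{\gamma\in PK:\gamma_0=e\}$. For $\alpha,\beta\in PK$ put $(\alpha*\beta)_t=\alpha_{2t}$ for $t<\tfrac12$, $(\alpha*\beta)_t=\alpha_1\beta_0^{-1}\beta_{2t-1}$ for $t\ge\tfrac12$, and $(\gamma^{-1})_t=\gamma_{1-t}$. Up to reparametrization by increasing bijections of $[0,1]$, a path $\alpha*\zeta*\zeta^{-1}*\beta$ reduces to $\alpha*\beta$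 (where $\alpha$ or $\beta$ may be absent; $\zeta*\zeta^{-1}$ reduces to the constant path $c_e$). A path is tree-like if finitely many reductions lead to $c_e$; $\alpha\sim_t\beta$ means that $\alpha*\beta^{-1}$ is tree-like, and $\widetilde P K$ is the quotient of $PK$ by (the equivalence relation generated by) $\sim_t$. Define $T_{\mathrm{IdInit}}:PG\to PG_e$, $\gamma\mapsto \ell_{\gamma_0}*\gamma$, and $T_{\mathrm{Time}}:PG_e\to\widetilde P(G\times\mathbb R)$, $\gamma\mapsto[t\mapsto(\gamma_t,t)]$. Then: 1. The composition $T_{\mathrm{Time}}\circ T_{\mathrm{IdInit}}:PG\to\widetilde P(G\times\mathbb R)$ is injective. 2. For every ordered basis $(b_1,\dots,b_n)$ of the Lie algebra $\mathfrak g\oplus\mathbb R$ of $G\times\mathbb R$, with dual basis $(\omega_i)$, let $S(\gamma)=1+\sum_{m\ge1}\sum_{i_1,\dots,i_m}S^{(i_1,\dots,i_m)}(\gamma)\,b_{i_1}\otimes\cdots\otimes b_{i_m}\in T((\mathfrak g\oplus\mathbb R))=\prod_{m\ge0}(\mathfrak g\oplus\mathbb R)^{\otimes m}$ be the path signature, $S^{(i_1,\dots,i_m)}(\gamma)=\int_{0<t_1<\dots<t_m<1}\omega_{i_1}(\gamma'_{t_1})\cdots\omega_{i_m}(\gamma'_{t_m})\,dt_1\cdots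 dt_m$. Then the feature map $PG\to T((\mathfrak g\oplus\mathbb R))$ which sends $\gamma$ to the signature of the path $t\mapsto\big((\ell_{\gamma_0}*\gamma)_t,t\big)$ is injective. -/

import Mathlib

open Set Filter Topology
open scoped Manifold ContDiff TensorProduct

noncomputable section

namespace LiePath

/-! ### The additive group `ℝ`, written multiplicatively, as a Lie group -/

instance instChartedSpaceMultiplicativeReal : ChartedSpace ℝ (Multiplicative ℝ) :=
  chartedSpaceSelf ℝ

instance instLieGroupMultiplicativeReal : LieGroup 𝓘(ℝ, ℝ) ∞ (Multiplicative ℝ) where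
  compatible := (inferInstance : IsManifold 𝓘(ℝ, ℝ) ∞ ℝ).compatible
  contMDiff_mul := contMDiff_add 𝓘(ℝ, ℝ) ∞ (G := ℝ)
  contMDiff_inv := contMDiff_neg 𝓘(ℝ, ℝ) ∞ (G := ℝ)

/-! ### Piecewise regular paths -/

set_option linter.unusedSectionVars false

section Paths

variable {E : Type*} [NormedAddCommGroup E] [NormedSpace ℝ E]
  {H : Type*} [TopologicalSpace H]
  {G : Type*} [TopologicalSpace G] [ChartedSpace H G] [Group G]

/-- The derivative `γ'_t` of a curve in `G`, moved to the Lie algebra `T_e G` by the differential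
of left translation by `γ_t⁻¹`. -/
def leftVelocity (I : ModelWithCorners ℝ E H) (γ : ℝ → G) (t : ℝ) : GroupLieAlgebra I G :=
  (mfderiv I I (fun x : G => (γ t)⁻¹ * x) (γ t) (mfderiv 𝓘(ℝ, ℝ) I γ t (1 : ℝ)) : E)

/-- Near the time `t` the curve is continuously differentiable, and either its derivative does
not vanish (the curve is regular at `t`) or the curve is constant near `t`. -/
structure IsGoodAt (I : ModelWithCorners ℝ E H) (γ : ℝ → G) (t : ℝ) : Prop where
  differentiable : ∀ᶠ s in 𝓝 t, MDifferentiableAt 𝓘(ℝ, ℝ) I γ s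
  continuous : ContinuousAt (leftVelocity I γ) t
  regular_or_const : leftVelocity I γ t ≠ 0 ∨ ∀ᶠ s in 𝓝 t, γ s = γ t

/-- There are finitely many break points (the elements of `F`) between which the derivative is
continuous, and on each open interval of `(0, 1)` without break points the curve is regular
(nowhere vanishing derivative) or constant: by connectedness, the alternative in `IsGoodAt` is
the same at all times of such an interval.  The derivative has one-sided limits everywhere. -/
structure IsPiecewiseRegular (I : ModelWithCorners ℝ E H) (γ : ℝ → G) : Prop where
  good : ∃ F : Finset ℝ, ∀ t ∈ Ioo (0 : ℝ) 1, t ∉ F → IsGoodAt I γ t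
  right_limit : ∀ t ∈ Ico (0 : ℝ) 1, ∃ v, Tendsto (leftVelocity I γ) (𝓝[>] t) (𝓝 v)
  left_limit : ∀ t ∈ Ioc (0 : ℝ) 1, ∃ v, Tendsto (leftVelocity I γ) (𝓝[<] t) (𝓝 v)

/-- The path space `PG`: continuous piecewise regular paths `[0, 1] → G`. -/
structure PathSpace (I : ModelWithCorners ℝ E H) (G : Type*) [TopologicalSpace G]
    [ChartedSpace H G] [Group G] where
  toFun : unitInterval → G
  continuous_toFun : Continuous toFun
  piecewise : IsPiecewiseRegular I (IccExtend zero_le_one toFun)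

variable {I : ModelWithCorners ℝ E H}

namespace PathSpace

@[ext] theorem ext {α β : PathSpace I G} (h : ∀ t, α.toFun t = β.toFun t) : α = β := by
  cases α; cases β; congr; exact funext h

/-- The path as a function on `ℝ`, constant before time `0` and after time `1`. -/
def extend (γ : PathSpace I G) : ℝ → G := IccExtend zero_le_one γ.toFun

theorem continuous_extend (γ : PathSpace I G) : Continuous γ.extend :=
  γ.continuous_toFun.Icc_extend'

end PathSpace

theorem affine_symm {G : Type*} [Group G] {γ δ : ℝ → G} {t a b : ℝ} {g : G} (ha : a ≠ 0)
    (hδ : δ =ᶠ[𝓝 t] fun s => g * γ (a * s + b)) :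
    γ =ᶠ[𝓝 (a * t + b)] fun s => g⁻¹ * δ (a⁻¹ * s + (- a⁻¹ * b)) := by
  have hc : Tendsto (fun s : ℝ => a⁻¹ * s + (- a⁻¹ * b)) (𝓝 (a * t + b)) (𝓝 t) := by
    have : ContinuousAt (fun s : ℝ => a⁻¹ * s + (- a⁻¹ * b)) (a * t + b) := by fun_prop
    convert this.tendsto using 2
    field_simp; ring
  filter_upwards [hc.eventually hδ] with s hs
  rw [hs]
  simp only [inv_mul_cancel_left]
  congr 1
  field_simp; ring


theorem leftVelocity_of_not {γ : ℝ → G} {t : ℝ}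
    (h : ¬ MDifferentiableAt 𝓘(ℝ, ℝ) I γ t) : leftVelocity I γ t = 0 := by
  unfold leftVelocity
  rw [mfderiv_zero_of_not_mdifferentiableAt h]
  exact map_zero (mfderiv I I (fun x : G => (γ t)⁻¹ * x) (γ t))


variable [LieGroup I ∞ G]


theorem mdifferentiable_mulLeft (g : G) : MDifferentiable I I (fun x : G => g * x) :=
  (contMDiff_mul_left (I := I) (n := ∞)).mdifferentiable (by simp)

theorem leftVelocity_eq {γ : ℝ → G} {t : ℝ}
    (h : MDifferentiableAt 𝓘(ℝ, ℝ) I γ t) :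
    leftVelocity I γ t =
      (mfderiv 𝓘(ℝ, ℝ) I (fun s => (γ t)⁻¹ * γ s) t (1 : ℝ) : E) := by
  have := mfderiv_comp t (mdifferentiable_mulLeft (I := I) (γ t)⁻¹ (γ t)) h
  unfold leftVelocity
  change _ = (mfderiv 𝓘(ℝ, ℝ) I ((fun x => (γ t)⁻¹ * x) ∘ γ) t (1 : ℝ) : E)
  rw [this]; rfl

theorem mdifferentiableAt_affine {γ δ : ℝ → G} {t a b : ℝ} {g : G}
    (hδ : δ =ᶠ[𝓝 t] fun s => g * γ (a * s + b))
    (h : MDifferentiableAt 𝓘(ℝ, ℝ) I γ (a * t + b)) :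
    MDifferentiableAt 𝓘(ℝ, ℝ) I δ t := by
  refine MDifferentiableAt.congr_of_eventuallyEq ?_ hδ
  have h1 : MDifferentiableAt 𝓘(ℝ, ℝ) 𝓘(ℝ, ℝ) (fun s : ℝ => a * s + b) t :=
    (by fun_prop : DifferentiableAt ℝ (fun s : ℝ => a * s + b) t).mdifferentiableAt
  have h2 : MDifferentiableAt 𝓘(ℝ, ℝ) I (γ ∘ fun s : ℝ => a * s + b) t :=
    MDifferentiableAt.comp t h h1
  exact MDifferentiableAt.comp t (mdifferentiable_mulLeft (I := I) g _) h2

theorem leftVelocity_affine_of_mdiff {γ δ : ℝ → G} {t a b : ℝ} {g : G}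
    (hδ : δ =ᶠ[𝓝 t] fun s => g * γ (a * s + b))
    (h : MDifferentiableAt 𝓘(ℝ, ℝ) I γ (a * t + b)) :
    leftVelocity I δ t = a • leftVelocity I γ (a * t + b) := by
  rw [leftVelocity_eq (mdifferentiableAt_affine hδ h), leftVelocity_eq h]
  have e : (fun s => (δ t)⁻¹ * δ s) =ᶠ[𝓝 t]
      ((fun s => (γ (a * t + b))⁻¹ * γ s) ∘ fun s : ℝ => a * s + b) := by
    filter_upwards [hδ] with s hs
    rw [hs, hδ.self_of_nhds]
    simp [mul_assoc]
  have h1 : HasMFDerivAt 𝓘(ℝ, ℝ) 𝓘(ℝ, ℝ) (fun s : ℝ => a * s + b) t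
      (a • ContinuousLinearMap.id ℝ ℝ) := by
    have : HasFDerivAt (fun s : ℝ => a * s + b) (a • ContinuousLinearMap.id ℝ ℝ) t :=
      ((hasFDerivAt_id t).const_mul a).add_const b
    exact this.hasMFDerivAt
  have h2 : MDifferentiableAt 𝓘(ℝ, ℝ) I (fun s => (γ (a * t + b))⁻¹ * γ s) (a * t + b) :=
    MDifferentiableAt.comp (a * t + b) (mdifferentiable_mulLeft (I := I) _ _) h
  have h3 := (HasMFDerivAt.comp t h2.hasMFDerivAt h1).congr_of_eventuallyEq e
  rw [h3.mfderiv]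
  change (mfderiv 𝓘(ℝ, ℝ) I (fun s => (γ (a * t + b))⁻¹ * γ s) (a * t + b)) (a • (1 : ℝ)) = _
  exact ContinuousLinearMap.map_smul (mfderiv 𝓘(ℝ, ℝ) I
    (fun s => (γ (a * t + b))⁻¹ * γ s) (a * t + b) : ℝ →L[ℝ] E) a (1 : ℝ)

theorem mdifferentiableAt_affine_iff {γ δ : ℝ → G} {t a b : ℝ} {g : G} (ha : a ≠ 0)
    (hδ : δ =ᶠ[𝓝 t] fun s => g * γ (a * s + b)) :
    MDifferentiableAt 𝓘(ℝ, ℝ) I δ t ↔ MDifferentiableAt 𝓘(ℝ, ℝ) I γ (a * t + b) := by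
  refine ⟨fun h => ?_, mdifferentiableAt_affine hδ⟩
  refine mdifferentiableAt_affine (affine_symm ha hδ) ?_
  convert h using 1
  field_simp; ring

theorem leftVelocity_affine {γ δ : ℝ → G} {t a b : ℝ} {g : G} (ha : a ≠ 0)
    (hδ : δ =ᶠ[𝓝 t] fun s => g * γ (a * s + b)) :
    leftVelocity I δ t = a • leftVelocity I γ (a * t + b) := by
  by_cases h : MDifferentiableAt 𝓘(ℝ, ℝ) I γ (a * t + b)
  · exact leftVelocity_affine_of_mdiff hδ h
  · rw [leftVelocity_of_not (I := I) h, leftVelocity_of_not (I := I)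
      (fun h' => h ((mdifferentiableAt_affine_iff ha hδ).1 h')), smul_zero]

theorem IsGoodAt.affine {γ δ : ℝ → G} {t a b : ℝ} {g : G} (ha : a ≠ 0)
    (hδ : δ =ᶠ[𝓝 t] fun s => g * γ (a * s + b)) (h : IsGoodAt I γ (a * t + b)) :
    IsGoodAt I δ t := by
  have hc : ContinuousAt (fun s : ℝ => a * s + b) t := by fun_prop
  have e : leftVelocity I δ =ᶠ[𝓝 t] fun s => a • leftVelocity I γ (a * s + b) := by
    filter_upwards [hδ.eventuallyEq_nhds] with s hs
    exact leftVelocity_affine ha hs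
  refine ⟨?_, ?_, ?_⟩
  · filter_upwards [hδ.eventuallyEq_nhds, hc.eventually h.differentiable] with s hs h's
    exact mdifferentiableAt_affine hs h's
  · refine ContinuousAt.congr ?_ e.symm
    exact (ContinuousAt.comp (f := fun s : ℝ => a * s + b) h.continuous hc).const_smul a
  · rcases h.regular_or_const with h | h
    · left; rw [leftVelocity_affine ha hδ]; exact smul_ne_zero ha h
    · right
      filter_upwards [hδ, hc.eventually h] with s hs h's
      rw [hs, h's, hδ.self_of_nhds]

theorem tendsto_leftVelocity_affine {γ δ : ℝ → G} {a b : ℝ} {g : G} (ha : a ≠ 0)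
    {l l' : Filter ℝ} (hl : Tendsto (fun s => a * s + b) l l')
    (hδ : ∀ᶠ t in l, δ =ᶠ[𝓝 t] fun s => g * γ (a * s + b))
    (h : ∃ v, Tendsto (leftVelocity I γ) l' (𝓝 v)) :
    ∃ v, Tendsto (leftVelocity I δ) l (𝓝 v) := by
  obtain ⟨v, hv⟩ := h
  refine ⟨a • v, ((hv.comp hl).const_smul a).congr' ?_⟩
  filter_upwards [hδ] with t ht
  exact (leftVelocity_affine ha ht).symm

theorem tendsto_affine_nhdsGT {a b t : ℝ} (ha : 0 < a) :
    Tendsto (fun s => a * s + b) (𝓝[>] t) (𝓝[>] (a * t + b)) := by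
  refine tendsto_nhdsWithin_iff.2 ⟨?_, ?_⟩
  · exact ((by fun_prop : Continuous fun s : ℝ => a * s + b).tendsto t).mono_left
      nhdsWithin_le_nhds
  · filter_upwards [self_mem_nhdsWithin] with s hs
    have : t < s := hs
    simp only [mem_Ioi]; nlinarith

theorem tendsto_affine_nhdsLT {a b t : ℝ} (ha : 0 < a) :
    Tendsto (fun s => a * s + b) (𝓝[<] t) (𝓝[<] (a * t + b)) := by
  refine tendsto_nhdsWithin_iff.2 ⟨?_, ?_⟩
  · exact ((by fun_prop : Continuous fun s : ℝ => a * s + b).tendsto t).mono_left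
      nhdsWithin_le_nhds
  · filter_upwards [self_mem_nhdsWithin] with s hs
    have : s < t := hs
    simp only [mem_Iio]; nlinarith

theorem isPiecewiseRegular_concat {α β δ : ℝ → G} {g : G}
    (hα : IsPiecewiseRegular I α) (hβ : IsPiecewiseRegular I β)
    (h1 : ∀ s < 1 / 2, δ s = α (2 * s)) (h2 : ∀ s > 1 / 2, δ s = g * β (2 * s - 1)) :
    IsPiecewiseRegular I δ := by
  have e1 : ∀ t < (1 / 2 : ℝ), δ =ᶠ[𝓝 t] fun s => (1 : G) * α (2 * s + 0) := fun t ht => by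
    filter_upwards [Iio_mem_nhds ht] with s hs
    simpa using h1 s hs
  have e2 : ∀ t > (1 / 2 : ℝ), δ =ᶠ[𝓝 t] fun s => g * β (2 * s + -1) := fun t ht => by
    filter_upwards [Ioi_mem_nhds ht] with s hs
    simpa [sub_eq_add_neg] using h2 s hs
  obtain ⟨Fα, hFα⟩ := hα.good
  obtain ⟨Fβ, hFβ⟩ := hβ.good
  classical
  refine ⟨⟨(Fα.image (fun t => t / 2)) ∪ (Fβ.image (fun t => (t + 1) / 2)) ∪ {1 / 2}, ?_⟩, ?_, ?_⟩
  · intro t ht hF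
    simp only [Finset.mem_union, Finset.mem_image, Finset.mem_singleton, not_or, not_exists,
      not_and] at hF
    obtain ⟨⟨hF1, hF2⟩, hF3⟩ := hF
    rcases lt_or_gt_of_ne hF3 with h | h
    · refine IsGoodAt.affine two_ne_zero (e1 t h) (hFα _ ⟨by linarith [ht.1], by linarith⟩ ?_)
      exact fun hm => hF1 _ hm (by ring)
    · refine IsGoodAt.affine two_ne_zero (e2 t h) (hFβ _ ⟨by linarith, by linarith [ht.2]⟩ ?_)
      exact fun hm => hF2 _ hm (by ring)
  · intro t ht
    rcases lt_or_ge t (1 / 2) with h | h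
    · refine tendsto_leftVelocity_affine (g := 1) two_ne_zero (tendsto_affine_nhdsGT two_pos) ?_
        (hα.right_limit (2 * t + 0) ⟨by linarith [ht.1], by linarith⟩)
      filter_upwards [mem_nhdsWithin_of_mem_nhds (Iio_mem_nhds h)] with s hs using e1 s hs
    · refine tendsto_leftVelocity_affine (g := g) two_ne_zero (tendsto_affine_nhdsGT two_pos) ?_
        (hβ.right_limit (2 * t + -1) ⟨by linarith, by linarith [ht.2]⟩)
      filter_upwards [self_mem_nhdsWithin] with s hs using e2 s (lt_of_le_of_lt h hs)
  · intro t ht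
    rcases le_or_gt t (1 / 2) with h | h
    · refine tendsto_leftVelocity_affine (g := 1) two_ne_zero (tendsto_affine_nhdsLT two_pos) ?_
        (hα.left_limit (2 * t + 0) ⟨by linarith [ht.1], by linarith⟩)
      filter_upwards [self_mem_nhdsWithin] with s hs using e1 s (lt_of_lt_of_le hs h)
    · refine tendsto_leftVelocity_affine (g := g) two_ne_zero (tendsto_affine_nhdsLT two_pos) ?_
        (hβ.left_limit (2 * t + -1) ⟨by linarith, by linarith [ht.2]⟩)
      filter_upwards [mem_nhdsWithin_of_mem_nhds (Ioi_mem_nhds h)] with s hs using e2 s hs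

theorem isPiecewiseRegular_reverse {γ δ : ℝ → G} (hγ : IsPiecewiseRegular I γ)
    (h : ∀ s, δ s = γ (1 - s)) : IsPiecewiseRegular I δ := by
  have e : ∀ t, δ =ᶠ[𝓝 t] fun s => (1 : G) * γ (-1 * s + 1) := fun t =>
    Eventually.of_forall fun s => by
      simp only [h s, one_mul]; congr 1; ring
  have hc : Continuous fun s : ℝ => -1 * s + 1 := by fun_prop
  obtain ⟨F, hF⟩ := hγ.good
  classical
  refine ⟨⟨F.image fun t => 1 - t, ?_⟩, ?_, ?_⟩
  · intro t ht hm
    refine IsGoodAt.affine (by norm_num) (e t) (hF _ ⟨by linarith [ht.2], by linarith [ht.1]⟩ ?_)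
    exact fun h' => hm (Finset.mem_image.2 ⟨_, h', by ring⟩)
  · intro t ht
    refine tendsto_leftVelocity_affine (by norm_num) (tendsto_nhdsWithin_iff.2
      ⟨(hc.tendsto t).mono_left nhdsWithin_le_nhds, ?_⟩) (Eventually.of_forall e)
        (hγ.left_limit (-1 * t + 1) ⟨by linarith [ht.2], by linarith [ht.1]⟩)
    filter_upwards [self_mem_nhdsWithin] with s hs
    have : t < s := hs
    simp only [mem_Iio]; linarith
  · intro t ht
    refine tendsto_leftVelocity_affine (by norm_num) (tendsto_nhdsWithin_iff.2
      ⟨(hc.tendsto t).mono_left nhdsWithin_le_nhds, ?_⟩) (Eventually.of_forall e)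
        (hγ.right_limit (-1 * t + 1) ⟨by linarith [ht.2], by linarith [ht.1]⟩)
    filter_upwards [self_mem_nhdsWithin] with s hs
    have : s < t := hs
    simp only [mem_Ioi]; linarith

theorem isPiecewiseRegular_const (g : G) : IsPiecewiseRegular I (fun _ : ℝ => g) := by
  have h0 : leftVelocity I (fun _ : ℝ => g) = fun _ => 0 := by
    funext t
    unfold leftVelocity
    rw [mfderiv_const]
    exact map_zero (mfderiv I I (fun x : G => g⁻¹ * x) g)
  refine ⟨⟨∅, fun t _ _ => ⟨Eventually.of_forall fun _ => mdifferentiableAt_const, ?_,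
    Or.inr (Eventually.of_forall fun _ => rfl)⟩⟩, fun t _ => ⟨0, ?_⟩, fun t _ => ⟨0, ?_⟩⟩
  · rw [h0]; exact continuousAt_const
  · rw [h0]; exact tendsto_const_nhds
  · rw [h0]; exact tendsto_const_nhds

/-! ### Operations on paths -/

namespace PathSpace

/-- The concatenation `α * β`, where `β` is left translated so as to start where `α` ends. -/
def concat (α β : PathSpace I G) : PathSpace I G where
  toFun t := if (t : ℝ) < 1 / 2 then α.extend (2 * t)
    else α.toFun 1 * (β.toFun 0)⁻¹ * β.extend (2 * t - 1)
  continuous_toFun := by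
    have : IsTopologicalGroup G := topologicalGroup_of_lieGroup I ∞
    have h : (fun t : unitInterval => if (t : ℝ) < 1 / 2 then α.extend (2 * t)
        else α.toFun 1 * (β.toFun 0)⁻¹ * β.extend (2 * t - 1)) =
        fun t : unitInterval => if 1 / 2 ≤ (t : ℝ) then
          α.toFun 1 * (β.toFun 0)⁻¹ * β.extend (2 * t - 1) else α.extend (2 * t) := by
      funext t
      simp only [← not_lt, ite_not]
    rw [h]
    refine Continuous.if_le ?_ ?_ continuous_const continuous_subtype_val ?_
    · exact continuous_const.mul (β.continuous_extend.comp (by fun_prop))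
    · exact α.continuous_extend.comp (by fun_prop)
    · intro t ht
      have h1 : (2 : ℝ) * t = 1 := by rw [← ht]; norm_num
      rw [h1, sub_self]
      unfold extend
      rw [IccExtend_left, IccExtend_right]
      exact inv_mul_cancel_right _ _
  piecewise := by
    refine isPiecewiseRegular_concat (g := α.toFun 1 * (β.toFun 0)⁻¹)
      α.piecewise β.piecewise ?_ ?_
    · intro s hs
      rcases le_total s 0 with h0 | h0
      · rw [IccExtend_of_le_left _ _ h0]
        change (if ((0 : ℝ)) < 1 / 2 then α.extend (2 * (0 : ℝ)) else _) = _
        rw [if_pos (by norm_num)]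
        unfold extend
        rw [IccExtend_of_le_left _ _ (by linarith), IccExtend_of_le_left _ _ (by linarith)]
      · rw [IccExtend_of_mem _ _ (⟨h0, by linarith⟩ : s ∈ Icc (0 : ℝ) 1)]
        simp only [hs, if_true]; rfl
    · intro s hs
      have hs' : ¬ s < 1 / 2 := by linarith
      rcases le_total 1 s with h0 | h0
      · rw [IccExtend_of_right_le _ _ h0]
        change (if ((1 : ℝ)) < 1 / 2 then α.extend (2 * (1 : ℝ)) else
          α.toFun 1 * (β.toFun 0)⁻¹ * β.extend (2 * (1 : ℝ) - 1)) = _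
        rw [if_neg (by norm_num)]
        unfold extend
        rw [IccExtend_of_right_le _ β.toFun (by linarith : 1 ≤ 2 * s - 1),
          IccExtend_of_right_le _ β.toFun (by norm_num : (1 : ℝ) ≤ 2 * 1 - 1)]
      · rw [IccExtend_of_mem _ _ (⟨by linarith, h0⟩ : s ∈ Icc (0 : ℝ) 1)]
        simp only [hs', if_false]; rfl

/-- The path run backwards, `t ↦ γ_{1-t}`. -/
def reverse (γ : PathSpace I G) : PathSpace I G where
  toFun t := γ.toFun (unitInterval.symm t)
  continuous_toFun := γ.continuous_toFun.comp unitInterval.continuous_symm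
  piecewise := by
    refine isPiecewiseRegular_reverse γ.piecewise fun s => ?_
    simp only [IccExtend, Function.comp_apply]
    congr 1
    apply Subtype.ext
    rw [unitInterval.coe_symm_eq]
    simp only [coe_projIcc]
    rcases le_total s 0 with h | h
    · rw [min_eq_right (by linarith), max_eq_left h, min_eq_left (by linarith),
        max_eq_right (by linarith)]; norm_num
    · rcases le_total s 1 with h' | h'
      · rw [min_eq_right h', max_eq_right h, min_eq_right (by linarith),
          max_eq_right (by linarith)]
      · rw [min_eq_left h', max_eq_right (by norm_num), min_eq_right (by linarith),
          max_eq_left (by linarith)]; norm_num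

/-- The constant path at `g`. -/
def const (g : G) : PathSpace I G where
  toFun _ := g
  continuous_toFun := continuous_const
  piecewise := isPiecewiseRegular_const g

end PathSpace

/-! ### Tree-like equivalence -/

/-- `γ` is a reparametrization of `δ`. -/
def IsReparametrization (γ δ : PathSpace I G) : Prop :=
  ∃ φ : unitInterval ≃o unitInterval, ∀ t, γ.toFun t = δ.toFun (φ t)

/-- One reduction step: up to reparametrization, `α * ζ * ζ⁻¹ * β` reduces to `α * β`.  The
parts `α` and `β` may be absent; the reduction of `ζ * ζ⁻¹` is the constant path at the
identity. -/
inductive Reduces : PathSpace I G → PathSpace I G → Prop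
  | middle (γ α ζ β : PathSpace I G)
      (h : IsReparametrization γ (((α.concat ζ).concat ζ.reverse).concat β)) :
      Reduces γ (α.concat β)
  | left (γ ζ β : PathSpace I G)
      (h : IsReparametrization γ ((ζ.concat ζ.reverse).concat β)) : Reduces γ β
  | right (γ α ζ : PathSpace I G)
      (h : IsReparametrization γ ((α.concat ζ).concat ζ.reverse)) : Reduces γ α
  | all (γ ζ : PathSpace I G)
      (h : IsReparametrization γ (ζ.concat ζ.reverse)) : Reduces γ (PathSpace.const 1)

/-- A path is tree-like if finitely many reductions lead to the constant path at the identity. -/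
def IsTreeLike (γ : PathSpace I G) : Prop :=
  Relation.ReflTransGen Reduces γ (PathSpace.const 1)

def TreeLikeEquiv (α β : PathSpace I G) : Prop := IsTreeLike (α.concat β.reverse)

/-- `P̃G`, the quotient of `PG` by tree-like equivalence. -/
def ReducedPathSpace (I : ModelWithCorners ℝ E H) (G : Type*) [TopologicalSpace G]
    [ChartedSpace H G] [Group G] [LieGroup I ∞ G] : Type _ :=
  Quot (TreeLikeEquiv (I := I) (G := G))

/-- The tree-like equivalence class of a path. -/
def PathSpace.treeClass (γ : PathSpace I G) : ReducedPathSpace I G := Quot.mk _ γ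

/-! ### The exponential map -/

section Exponential

variable [FiniteDimensional ℝ E] [I.Boundaryless] [T2Space G]

theorem contMDiff_invariant (X : GroupLieAlgebra I G) :
    ContMDiff I I.tangent 1
      (fun g : G => (⟨g, mulInvariantVectorField X g⟩ : TangentBundle I G)) := by
  have : LieGroup I (minSmoothness ℝ 3) G := 
    LieGroup.of_le (n := ∞) (by simp only [minSmoothness_of_isRCLikeNormedField]; exact ENat.LEInfty.out)
  exact (contMDiff_mulInvariantVectorField X).of_le (by simp)

theorem mfderiv_mulLeft_invariant (X : GroupLieAlgebra I G) (g h : G) :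
    (mfderiv I I (fun x : G => g * x) h (mulInvariantVectorField X h) : E) =
      (mulInvariantVectorField X (g * h) : E) := by
  have h1 : MDifferentiableAt I I (fun x : G => g * x) (h * 1) := mdifferentiable_mulLeft _ _
  have h2 := mfderiv_comp (1 : G) (f := fun x : G => h * x) h1 (mdifferentiable_mulLeft _ _)
  have h3 : ((fun x : G => g * x) ∘ fun x : G => h * x) = fun x : G => (g * h) * x := by
    funext x; simp [mul_assoc]
  rw [h3] at h2
  have h4 : ∀ k : G, k = h →
      (mfderiv I I (fun x : G => g * x) k (mulInvariantVectorField X h : E) : E) =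
      (mfderiv I I (fun x : G => g * x) h (mulInvariantVectorField X h : E) : E) := by
    rintro k rfl; rfl
  rw [← h4 (h * 1) (mul_one h)]
  unfold mulInvariantVectorField
  rw [h2]
  rfl

theorem isMIntegralCurveOn_mulLeft {γ : ℝ → G} {s : Set ℝ} {X : GroupLieAlgebra I G} (g : G)
    (h : IsMIntegralCurveOn γ (mulInvariantVectorField X : (x : G) → TangentSpace I x) s) :
    IsMIntegralCurveOn (fun t => g * γ t)
      (mulInvariantVectorField X : (x : G) → TangentSpace I x) s := by
  intro t ht
  have h1 := (mdifferentiable_mulLeft (I := I) g (γ t)).hasMFDerivAt.comp_hasMFDerivWithinAt t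
    (h t ht)
  refine h1.congr_mfderiv ?_
  ext
  change (mfderiv I I (fun x : G => g * x) (γ t) ((1 : ℝ) • (mulInvariantVectorField X (γ t))) : E)
    = ((1 : ℝ) • (mulInvariantVectorField X (g * γ t)) : E)
  have h2 := mfderiv_mulLeft_invariant X g (γ t)
  simp only [one_smul]
  exact h2

theorem exists_oneParam (X : GroupLieAlgebra I G) :
    ∃ ρ : ℝ → G, ρ 0 = 1 ∧
      IsMIntegralCurve ρ (mulInvariantVectorField X : (x : G) → TangentSpace I x) := by
  have : CompleteSpace E := FiniteDimensional.complete ℝ E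
  obtain ⟨γ, h0, hγ⟩ := exists_isMIntegralCurveAt_of_contMDiffAt_boundaryless (t₀ := 0)
    (contMDiff_invariant X (1 : G))
  obtain ⟨ε, hε, hγ⟩ := isMIntegralCurveAt_iff'.1 hγ
  refine exists_isMIntegralCurve_of_isMIntegralCurveOn (contMDiff_invariant X) hε (fun x => ?_) 1
  refine ⟨fun t => x * γ t, by simp [h0], isMIntegralCurveOn_mulLeft x ?_⟩
  convert hγ using 1
  rw [Real.ball_eq_Ioo]; simp

/-- The one-parameter subgroup `ρ_X` generated by `X`: the integral curve of the left-invariant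
vector field of `X` that passes through the identity at time `0`. -/
def oneParam (X : GroupLieAlgebra I G) : ℝ → G := (exists_oneParam X).choose

theorem oneParam_zero (X : GroupLieAlgebra I G) : oneParam X 0 = 1 :=
  (exists_oneParam X).choose_spec.1

theorem isMIntegralCurve_oneParam (X : GroupLieAlgebra I G) :
    IsMIntegralCurve (oneParam X) (mulInvariantVectorField X : (x : G) → TangentSpace I x) :=
  (exists_oneParam X).choose_spec.2

/-- The Lie exponential map `exp X = ρ_X(1)`. -/
def lieExp (X : GroupLieAlgebra I G) : G := oneParam X 1

theorem lieExp_smul (X : GroupLieAlgebra I G) (t : ℝ) : lieExp (t • X) = oneParam X t := by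
  have : CompleteSpace E := FiniteDimensional.complete ℝ E
  have h1 := (isMIntegralCurve_oneParam X).comp_mul t
  rw [← mulInvariantVectorField_smul] at h1
  have h2 := isMIntegralCurve_Ioo_eq_of_contMDiff_boundaryless (t₀ := 0)
    (contMDiff_invariant (t • X)) (isMIntegralCurve_oneParam (t • X)) h1
    (by simp [oneParam_zero])
  have h3 := congrFun h2 1
  simpa [lieExp] using h3

theorem leftVelocity_oneParam (X : GroupLieAlgebra I G) (t : ℝ) :
    leftVelocity I (oneParam X) t = X := by
  have h := (isMIntegralCurve_oneParam X t).mfderiv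
  have h2 := mfderiv_mulLeft_invariant X (oneParam X t)⁻¹ (oneParam X t)
  unfold leftVelocity
  rw [h]
  change (mfderiv I I (fun x : G => (oneParam X t)⁻¹ * x) (oneParam X t)
    ((1 : ℝ) • mulInvariantVectorField X (oneParam X t)) : E) = X
  rw [one_smul]
  refine h2.trans ?_
  rw [inv_mul_cancel]
  unfold mulInvariantVectorField
  have h3 : (fun x : G => (1 : G) * x) = id := by funext x; simp
  rw [h3, mfderiv_id]
  rfl

theorem isPiecewiseRegular_oneParam (X : GroupLieAlgebra I G) {δ : ℝ → G}
    (hδ : ∀ s ∈ Ioo (0 : ℝ) 1, δ s = oneParam X s) : IsPiecewiseRegular I δ := by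
  have e : ∀ t ∈ Ioo (0 : ℝ) 1, δ =ᶠ[𝓝 t] oneParam X := fun t ht => by
    filter_upwards [Ioo_mem_nhds ht.1 ht.2] with s hs using hδ s hs
  have hv : ∀ t ∈ Ioo (0 : ℝ) 1, leftVelocity I δ t = X := fun t ht => by
    rw [← leftVelocity_oneParam X t]
    have : δ =ᶠ[𝓝 t] fun s => (1 : G) * oneParam X (1 * s + 0) := by simpa using e t ht
    simpa using leftVelocity_affine (I := I) one_ne_zero this
  have hd : ∀ t ∈ Ioo (0 : ℝ) 1, MDifferentiableAt 𝓘(ℝ, ℝ) I δ t := fun t ht =>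
    MDifferentiableAt.congr_of_eventuallyEq
      (isMIntegralCurve_oneParam X t).mdifferentiableAt (e t ht)
  refine ⟨⟨∅, fun t ht _ => ⟨?_, ?_, ?_⟩⟩, fun t ht => ⟨X, ?_⟩, fun t ht => ⟨X, ?_⟩⟩
  · filter_upwards [Ioo_mem_nhds ht.1 ht.2] with s hs using hd s hs
  · refine ContinuousAt.congr (f := fun _ => X) continuousAt_const ?_
    filter_upwards [Ioo_mem_nhds ht.1 ht.2] with s hs using (hv s hs).symm
  · by_cases hX : X = 0
    · right
      have hc : ∀ s, oneParam X s = 1 := fun s => by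
        have h1 : oneParam X (0 * s) = oneParam X s := by
          rw [← lieExp_smul, ← lieExp_smul, hX, smul_zero, smul_zero]
        rw [← h1, zero_mul, oneParam_zero]
      filter_upwards [e t ht] with s hs
      rw [hs, hδ t ht, hc, hc]
    · left; rw [hv t ht]; exact hX
  · refine tendsto_const_nhds.congr' ?_
    filter_upwards [Ioo_mem_nhdsGT ht.2] with s hs
      using (hv s ⟨lt_of_le_of_lt ht.1 hs.1, hs.2⟩).symm
  · refine tendsto_const_nhds.congr' ?_
    filter_upwards [Ioo_mem_nhdsLT ht.1] with s hs
      using (hv s ⟨hs.1, lt_of_lt_of_le hs.2 ht.2⟩).symm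

namespace PathSpace

/-- The exponential path `t ↦ exp (t X) = ρ_X(t)` on `[0, 1]`, from `e` to `exp X`. -/
def exponential (X : GroupLieAlgebra I G) : PathSpace I G where
  toFun t := lieExp ((t : ℝ) • X)
  continuous_toFun := by
    simp only [lieExp_smul]
    exact (continuous_iff_continuousAt.2
      fun t => (isMIntegralCurve_oneParam X t).continuousAt).comp continuous_subtype_val
  piecewise := isPiecewiseRegular_oneParam X fun s hs => by
    rw [IccExtend_of_mem _ _ ⟨hs.1.le, hs.2.le⟩]
    exact lieExp_smul X s

end PathSpace
end Exponential

/-! ### The two path transformations -/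

/-- `PG_e`, the paths in `PG` that start at the identity. -/
def BasedPathSpace (I : ModelWithCorners ℝ E H) (G : Type*) [TopologicalSpace G]
    [ChartedSpace H G] [Group G] : Type _ :=
  {γ : PathSpace I G // γ.toFun 0 = 1}

/-- The identity initialized transformation `γ ↦ ℓ_{γ_0} * γ`.  Here `ℓ_g` is the exponential
path `t ↦ exp (t log g)` from `e` to `g`, for a choice of a logarithm of each `g`. -/
def idInit [FiniteDimensional ℝ E] [I.Boundaryless] [T2Space G]
    (log : G → GroupLieAlgebra I G) (γ : PathSpace I G) : BasedPathSpace I G :=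
  ⟨(PathSpace.exponential (log (γ.toFun 0))).concat γ, by
    change (if ((0 : ℝ)) < 1 / 2 then (PathSpace.exponential (log (γ.toFun 0))).extend (2 * (0 : ℝ))
      else _) = 1
    rw [if_pos (by norm_num), mul_zero]
    unfold PathSpace.extend
    rw [IccExtend_left]
    change lieExp ((0 : ℝ) • log (γ.toFun 0)) = 1
    rw [lieExp_smul, oneParam_zero]⟩

theorem leftVelocity_time {γ : ℝ → G} {δ : ℝ → G × Multiplicative ℝ} {t : ℝ}
    (h : MDifferentiableAt 𝓘(ℝ, ℝ) I γ t)
    (hδ : δ =ᶠ[𝓝 t] fun s => (γ s, Multiplicative.ofAdd s)) :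
    MDifferentiableAt 𝓘(ℝ, ℝ) (I.prod 𝓘(ℝ, ℝ)) δ t ∧
    (leftVelocity (I.prod 𝓘(ℝ, ℝ)) δ t : E × ℝ) = ((leftVelocity I γ t : E), (1 : ℝ)) := by
  have h1 : HasMFDerivAt 𝓘(ℝ, ℝ) 𝓘(ℝ, ℝ)
      (fun s : ℝ => (Multiplicative.ofAdd s : Multiplicative ℝ)) t
      (ContinuousLinearMap.id ℝ ℝ) := hasMFDerivAt_id (I := 𝓘(ℝ, ℝ)) t
  have hd : MDifferentiableAt 𝓘(ℝ, ℝ) (I.prod 𝓘(ℝ, ℝ)) δ t :=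
    (h.prodMk h1.mdifferentiableAt).congr_of_eventuallyEq hδ
  refine ⟨hd, ?_⟩
  have h2 : MDifferentiableAt 𝓘(ℝ, ℝ) I (fun s => (γ t)⁻¹ * γ s) t :=
    MDifferentiableAt.comp t (mdifferentiable_mulLeft (I := I) _ _) h
  have h3 : HasMFDerivAt 𝓘(ℝ, ℝ) 𝓘(ℝ, ℝ)
      (fun s : ℝ => (Multiplicative.ofAdd t)⁻¹ * (Multiplicative.ofAdd s : Multiplicative ℝ)) t
      (ContinuousLinearMap.id ℝ ℝ) :=
    ((hasFDerivAt_id t).const_add (-t)).hasMFDerivAt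
  have e : (fun s => (δ t)⁻¹ * δ s) =ᶠ[𝓝 t] fun s => ((γ t)⁻¹ * γ s,
      (Multiplicative.ofAdd t)⁻¹ * (Multiplicative.ofAdd s : Multiplicative ℝ)) := by
    filter_upwards [hδ] with s hs
    rw [hs, hδ.self_of_nhds]; rfl
  have h4 := (h2.hasMFDerivAt.prodMk h3).congr_of_eventuallyEq e
  rw [leftVelocity_eq hd, leftVelocity_eq h, h4.mfderiv]
  rfl

theorem isPiecewiseRegular_time {γ : ℝ → G} {δ : ℝ → G × Multiplicative ℝ}
    (hγ : IsPiecewiseRegular I γ)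
    (hδ : ∀ s ∈ Ioo (0 : ℝ) 1, δ s = (γ s, Multiplicative.ofAdd s)) :
    IsPiecewiseRegular (I.prod 𝓘(ℝ, ℝ)) δ := by
  have e : ∀ t ∈ Ioo (0 : ℝ) 1, δ =ᶠ[𝓝 t] fun s => (γ s, Multiplicative.ofAdd s) :=
    fun t ht => by
      filter_upwards [Ioo_mem_nhds ht.1 ht.2] with s hs using hδ s hs
  obtain ⟨F, hF⟩ := hγ.good
  have hv : ∀ t ∈ Ioo (0 : ℝ) 1, MDifferentiableAt 𝓘(ℝ, ℝ) I γ t →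
      (leftVelocity (I.prod 𝓘(ℝ, ℝ)) δ t : E × ℝ) = ((leftVelocity I γ t : E), (1 : ℝ)) :=
    fun t ht h => (leftVelocity_time h (e t ht)).2
  have hfin : ∀ t : ℝ, ∀ᶠ s in 𝓝[≠] t, s ∉ F := fun t => by
    have : ((F : Set ℝ) \ {t})ᶜ ∈ 𝓝 t :=
      (F.finite_toSet.subset sdiff_subset).isClosed.isOpen_compl.mem_nhds (by simp)
    filter_upwards [mem_nhdsWithin_of_mem_nhds this, self_mem_nhdsWithin] with s hs hst hsF
    exact hs ⟨hsF, hst⟩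
  refine ⟨⟨F, fun t ht htF => ?_⟩, fun t ht => ?_, fun t ht => ?_⟩
  · have hg := hF t ht htF
    refine ⟨?_, ?_, Or.inl fun h0 => ?_⟩
    · filter_upwards [Ioo_mem_nhds ht.1 ht.2, hg.differentiable] with s hs hd
      exact (leftVelocity_time hd (e s hs)).1
    · have hc : ContinuousAt (fun s => ((leftVelocity I γ s : E), (1 : ℝ))) t :=
        ContinuousAt.prodMk hg.continuous continuousAt_const
      refine ContinuousAt.congr (f := fun s => ((leftVelocity I γ s : E), (1 : ℝ))) hc ?_
      filter_upwards [Ioo_mem_nhds ht.1 ht.2, hg.differentiable] with s hs hd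
      exact (hv s hs hd).symm
    · have h1 := hv t ht hg.differentiable.self_of_nhds
      rw [h0] at h1
      have h2 : (0 : ℝ) = 1 := congrArg Prod.snd h1
      exact zero_ne_one h2
  · obtain ⟨v, hlim⟩ := hγ.right_limit t ht
    refine ⟨((v : E), (1 : ℝ)), ?_⟩
    have hc : Tendsto (fun s => ((leftVelocity I γ s : E), (1 : ℝ))) (𝓝[>] t)
        (𝓝 ((v : E), (1 : ℝ))) := Tendsto.prodMk_nhds hlim tendsto_const_nhds
    refine hc.congr' ?_
    filter_upwards [Ioo_mem_nhdsGT ht.2,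
      (hfin t).filter_mono (nhdsWithin_mono t fun s hs => ne_of_gt hs)] with s hs hsF
    have hs' : s ∈ Ioo (0 : ℝ) 1 := ⟨lt_of_le_of_lt ht.1 hs.1, hs.2⟩
    exact (hv s hs' (hF s hs' hsF).differentiable.self_of_nhds).symm
  · obtain ⟨v, hlim⟩ := hγ.left_limit t ht
    refine ⟨((v : E), (1 : ℝ)), ?_⟩
    have hc : Tendsto (fun s => ((leftVelocity I γ s : E), (1 : ℝ))) (𝓝[<] t)
        (𝓝 ((v : E), (1 : ℝ))) := Tendsto.prodMk_nhds hlim tendsto_const_nhds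
    refine hc.congr' ?_
    filter_upwards [Ioo_mem_nhdsLT ht.1,
      (hfin t).filter_mono (nhdsWithin_mono t fun s hs => ne_of_lt hs)] with s hs hsF
    have hs' : s ∈ Ioo (0 : ℝ) 1 := ⟨hs.1, lt_of_lt_of_le hs.2 ht.2⟩
    exact (hv s hs' (hF s hs' hsF).differentiable.self_of_nhds).symm

/-- The path `t ↦ (γ_t, t)` in `G × ℝ`. -/
def timePath (γ : BasedPathSpace I G) :
    PathSpace (I.prod 𝓘(ℝ, ℝ)) (G × Multiplicative ℝ) where
  toFun t := (γ.1.toFun t, Multiplicative.ofAdd (t : ℝ))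
  continuous_toFun := γ.1.continuous_toFun.prodMk
    (continuous_ofAdd.comp continuous_subtype_val)
  piecewise := isPiecewiseRegular_time γ.1.piecewise fun s hs => by
    rw [IccExtend_of_mem _ _ ⟨hs.1.le, hs.2.le⟩, IccExtend_of_mem _ _ ⟨hs.1.le, hs.2.le⟩]

/-- The time transformation `PG_e → P̃(G × ℝ)`. -/
def timeTransform (γ : BasedPathSpace I G) :
    ReducedPathSpace (I.prod 𝓘(ℝ, ℝ)) (G × Multiplicative ℝ) :=
  (timePath γ).treeClass

end Paths

/-! ### The path signature -/

section Signature

variable {E : Type*} [NormedAddCommGroup E] [NormedSpace ℝ E]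
  {H : Type*} [TopologicalSpace H] {I : ModelWithCorners ℝ E H}
  {G : Type*} [TopologicalSpace G] [ChartedSpace H G] [Group G]

/-- The iterated integral `S^J(γ)_t` of a multi-index `J = (i_1, …, i_m)`, with respect to a basis
`b` of the Lie algebra and its dual basis `ω`: it is `1` for `m = 0`, and
`∫_0^t S^{(i_1, …, i_{m-1})}(γ)_s ω_{i_m}(γ'_s) ds` otherwise. -/
def iteratedIntegral {ι : Type*} (b : Module.Basis ι ℝ (GroupLieAlgebra I G)) (γ : PathSpace I G) :
    (m : ℕ) → (Fin m → ι) → ℝ → ℝ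
  | 0, _, _ => 1
  | m + 1, J, t => ∫ s in (0 : ℝ)..t,
      iteratedIntegral b γ m (Fin.init J) s *
        b.coord (J (Fin.last m)) (leftVelocity I γ.extend s)

/-- `T((V)) = ∏_m V^{⊗ m}`. -/
abbrev TensorSeries (V : Type*) [AddCommGroup V] [Module ℝ V] : Type _ := (m : ℕ) → ⨂[ℝ]^m V

/-- The path signature: the element of `T((𝔤))` whose component of degree `m` is
`∑_J S^J(γ)_1 • b_{i_1} ⊗ ⋯ ⊗ b_{i_m}`. -/
def signature {ι : Type*} [Fintype ι] (b : Module.Basis ι ℝ (GroupLieAlgebra I G))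
    (γ : PathSpace I G) : TensorSeries (GroupLieAlgebra I G) :=
  fun m => ∑ J : Fin m → ι, iteratedIntegral b γ m J 1 •
    PiTensorProduct.tprod ℝ fun k => b (J k)

end Signature
end LiePath

end

namespace LiePath
open MeasureTheory

section Velocity

variable {E : Type*} [NormedAddCommGroup E] [NormedSpace ℝ E]
  {H : Type*} [TopologicalSpace H] {I : ModelWithCorners ℝ E H}
  {G : Type*} [TopologicalSpace G] [ChartedSpace H G] [Group G]

/-- The left velocity of a curve, as a function with values in the model space. -/
noncomputable def modelVelocity (I : ModelWithCorners ℝ E H) (γ : ℝ → G) (t : ℝ) : E :=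
  leftVelocity I γ t

theorem volume_restrict_sdiff_finset (s : Set ℝ) (F : Finset ℝ) :
    (volume : Measure ℝ).restrict (s \ F) = volume.restrict s :=
  Measure.restrict_congr_set (sdiff_null_ae_eq_self (F.finite_toSet.measure_zero _))

theorem isOpen_Ioo_sdiff_finset (a b : ℝ) (F : Finset ℝ) : IsOpen (Ioo a b \ (F : Set ℝ)) :=
  isOpen_Ioo.sdiff F.finite_toSet.isClosed

/-- A function with one-sided limits everywhere is bounded on a compact interval. -/
theorem exists_bound_of_tendsto {E : Type*} [NormedAddCommGroup E] {v : ℝ → E}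
    (hr : ∀ t ∈ Ico (0 : ℝ) 1, ∃ w, Tendsto v (𝓝[>] t) (𝓝 w))
    (hl : ∀ t ∈ Ioc (0 : ℝ) 1, ∃ w, Tendsto v (𝓝[<] t) (𝓝 w)) :
    ∃ C, ∀ t ∈ Ioo (0 : ℝ) 1, ‖v t‖ ≤ C := by
  have key : ∃ C, ∀ t ∈ Icc (0 : ℝ) 1 ∩ Ioo 0 1, ‖v t‖ ≤ C := by
    refine isCompact_Icc.induction_on (p := fun s => ∃ C, ∀ t ∈ s ∩ Ioo (0 : ℝ) 1, ‖v t‖ ≤ C)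
      ⟨0, by simp⟩ (fun s t hst ⟨C, hC⟩ => ⟨C, fun x hx => hC x ⟨hst hx.1, hx.2⟩⟩)
      (fun s t ⟨C, hC⟩ ⟨D, hD⟩ => ⟨max C D, ?_⟩) (fun t ht => ?_)
    · rintro x ⟨hx | hx, hx'⟩
      · exact (hC x ⟨hx, hx'⟩).trans (le_max_left _ _)
      · exact (hD x ⟨hx, hx'⟩).trans (le_max_right _ _)
    · have h1 : ∃ C, ∀ᶠ x in 𝓝[>] t, x ∈ Ioo (0 : ℝ) 1 → ‖v x‖ ≤ C := by
        rcases lt_or_ge t 1 with h | h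
        · obtain ⟨w, hw⟩ := hr t ⟨ht.1, h⟩
          refine ⟨‖w‖ + 1, ?_⟩
          filter_upwards [hw.norm.eventually (gt_mem_nhds (lt_add_one _))] with x hx _ using hx.le
        · refine ⟨0, ?_⟩
          filter_upwards [self_mem_nhdsWithin] with x hx h'
          exact absurd h'.2 (not_lt.2 (h.trans (le_of_lt hx)))
      have h2 : ∃ C, ∀ᶠ x in 𝓝[<] t, x ∈ Ioo (0 : ℝ) 1 → ‖v x‖ ≤ C := by
        rcases lt_or_ge 0 t with h | h
        · obtain ⟨w, hw⟩ := hl t ⟨h, ht.2⟩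
          refine ⟨‖w‖ + 1, ?_⟩
          filter_upwards [hw.norm.eventually (gt_mem_nhds (lt_add_one _))] with x hx _ using hx.le
        · refine ⟨0, ?_⟩
          filter_upwards [self_mem_nhdsWithin] with x hx h'
          exact absurd h'.1 (not_lt.2 (le_trans (le_of_lt hx) h))
      obtain ⟨C, hC⟩ := h1
      obtain ⟨D, hD⟩ := h2
      let B := max (max C D) ‖v t‖
      have h3 : ∀ᶠ x in 𝓝 t, x ∈ Ioo (0 : ℝ) 1 → ‖v x‖ ≤ B := by
        have h4 : ∀ᶠ x in 𝓝[≠] t, x ∈ Ioo (0 : ℝ) 1 → ‖v x‖ ≤ B := by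
          rw [← nhdsLT_sup_nhdsGT, eventually_sup]
          constructor
          · filter_upwards [hD] with x hx h using
              (hx h).trans ((le_max_right _ _).trans (le_max_left _ _))
          · filter_upwards [hC] with x hx h using
              (hx h).trans ((le_max_left _ _).trans (le_max_left _ _))
        rw [eventually_nhdsWithin_iff] at h4
        filter_upwards [h4] with x hx h
        by_cases hxt : x = t
        · rw [hxt]; exact le_max_right _ _
        · exact hx hxt h
      exact ⟨_, mem_nhdsWithin_of_mem_nhds h3, B, fun x hx => hx.1 hx.2⟩
  obtain ⟨C, hC⟩ := key
  exact ⟨C, fun t ht => hC t ⟨Ioo_subset_Icc_self ht, ht⟩⟩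

theorem intervalIntegrable_of_tendsto {E : Type*} [NormedAddCommGroup E] {v : ℝ → E} {F : Finset ℝ}
    (hc : ContinuousOn v (Ioo (0 : ℝ) 1 \ F))
    (hr : ∀ t ∈ Ico (0 : ℝ) 1, ∃ w, Tendsto v (𝓝[>] t) (𝓝 w))
    (hl : ∀ t ∈ Ioc (0 : ℝ) 1, ∃ w, Tendsto v (𝓝[<] t) (𝓝 w)) :
    IntervalIntegrable v volume 0 1 := by
  have hm : AEStronglyMeasurable v (volume.restrict (Ioo (0 : ℝ) 1)) := by
    rw [← volume_restrict_sdiff_finset _ F]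
    exact hc.aestronglyMeasurable (isOpen_Ioo_sdiff_finset 0 1 F).measurableSet
  obtain ⟨C, hC⟩ := exists_bound_of_tendsto hr hl
  rw [intervalIntegrable_iff_integrableOn_Ioo_of_le zero_le_one]
  exact ⟨hm, HasFiniteIntegral.restrict_of_bounded C (by simp)
    ((ae_restrict_iff' measurableSet_Ioo).2 (Eventually.of_forall hC))⟩

namespace IsPiecewiseRegular

variable {γ : ℝ → G}

theorem exists_finset (h : IsPiecewiseRegular I γ) : ∃ F : Finset ℝ,
    (∀ t ∈ Ioo (0 : ℝ) 1 \ (F : Set ℝ), MDifferentiableAt 𝓘(ℝ, ℝ) I γ t) ∧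
      ContinuousOn (modelVelocity I γ) (Ioo 0 1 \ F) := by
  obtain ⟨F, hF⟩ := h.good
  exact ⟨F, fun t ht => (hF t ht.1 ht.2).differentiable.self_of_nhds,
    fun t ht => ContinuousAt.continuousWithinAt (hF t ht.1 ht.2).continuous⟩

theorem intervalIntegrable_modelVelocity (h : IsPiecewiseRegular I γ) :
    IntervalIntegrable (modelVelocity I γ) volume 0 1 := by
  obtain ⟨F, -, hF⟩ := h.exists_finset
  exact intervalIntegrable_of_tendsto hF h.right_limit h.left_limit

end IsPiecewiseRegular
end Velocity

/-! ### Moments -/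

section Moments

variable {E : Type*} [NormedAddCommGroup E] [NormedSpace ℝ E]

theorem integral_smul_eq_zero_of_moments {v : ℝ → E} (hv : IntervalIntegrable v volume 0 1)
    (h : ∀ m : ℕ, ∫ s in (0 : ℝ)..1, s ^ m • v s = 0) {g : ℝ → ℝ} (hg : Continuous g) :
    ∫ s in (0 : ℝ)..1, g s • v s = 0 := by
  have hi : ∀ {f : ℝ → ℝ}, Continuous f → IntervalIntegrable (fun s => f s • v s) volume 0 1 :=
    fun hf => hv.continuousOn_smul hf.continuousOn
  have hp : ∀ p : Polynomial ℝ, ∫ s in (0 : ℝ)..1, p.eval s • v s = 0 := by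
    intro p
    simp only [Polynomial.eval_eq_sum_range, Finset.sum_smul]
    rw [intervalIntegral.integral_finsetSum fun i _ => hi (by fun_prop)]
    refine Finset.sum_eq_zero fun i _ => ?_
    simp only [mul_smul]
    rw [intervalIntegral.integral_smul, h, smul_zero]
  have hb : ∀ ε > 0, ‖∫ s in (0 : ℝ)..1, g s • v s‖ ≤ ε * ∫ s in (0 : ℝ)..1, ‖v s‖ := by
    intro ε hε
    obtain ⟨p, hpε⟩ := exists_polynomial_near_of_continuousOn 0 1 g hg.continuousOn ε hε
    have e : ∫ s in (0 : ℝ)..1, g s • v s = ∫ s in (0 : ℝ)..1, (g s - p.eval s) • v s := by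
      simp only [sub_smul]
      rw [intervalIntegral.integral_sub (hi hg) (hi p.continuous), hp, sub_zero]
    rw [e, ← intervalIntegral.integral_const_mul]
    refine intervalIntegral.norm_integral_le_of_norm_le zero_le_one
      (Eventually.of_forall fun s hs => ?_) (hv.norm.const_mul ε)
    rw [norm_smul]
    refine mul_le_mul_of_nonneg_right ?_ (norm_nonneg _)
    rw [Real.norm_eq_abs, abs_sub_comm]
    exact (hpε s ⟨hs.1.le, hs.2⟩).le
  rw [← norm_le_zero_iff]
  have hlim : Tendsto (fun ε : ℝ => ε * ∫ s in (0 : ℝ)..1, ‖v s‖) (𝓝[>] 0) (𝓝 0) := by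
    have : Continuous fun ε : ℝ => ε * ∫ s in (0 : ℝ)..1, ‖v s‖ := by fun_prop
    simpa using (this.tendsto 0).mono_left nhdsWithin_le_nhds
  refine ge_of_tendsto hlim ?_
  filter_upwards [self_mem_nhdsWithin] with ε hε using hb ε hε

/-- A piecewise continuous function whose moments vanish is zero at its points of continuity. -/
theorem eqOn_zero_of_moments [CompleteSpace E] {v : ℝ → E} {F : Finset ℝ} (hv : IntervalIntegrable v volume 0 1)
    (hc : ContinuousOn v (Ioo 0 1 \ F))
    (h : ∀ m : ℕ, ∫ s in (0 : ℝ)..1, s ^ m • v s = 0) : EqOn v 0 (Ioo 0 1 \ F) := by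
  have hO := isOpen_Ioo_sdiff_finset 0 1 F
  have hi : IntegrableOn v (Ioo 0 1) :=
    (intervalIntegrable_iff_integrableOn_Ioo_of_le zero_le_one).1 hv
  have hae : ∀ᵐ x, x ∈ Ioo (0 : ℝ) 1 → v x = 0 := by
    refine isOpen_Ioo.ae_eq_zero_of_integral_contDiff_smul_eq_zero hi.locallyIntegrableOn
      fun g hg _ hs => ?_
    have h0 := integral_smul_eq_zero_of_moments hv h hg.continuous
    rw [intervalIntegral.integral_of_le zero_le_one, integral_Ioc_eq_integral_Ioo] at h0
    rw [← h0]
    refine (setIntegral_eq_integral_of_forall_compl_eq_zero fun x hx => ?_).symm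
    rw [image_eq_zero_of_notMem_tsupport fun hx' => hx (hs hx'), zero_smul]
  refine Measure.eqOn_open_of_ae_eq (μ := volume) ?_ hO hc continuousOn_const
  rw [EventuallyEq, ae_restrict_iff' hO.measurableSet]
  filter_upwards [hae] with x hx hx' using hx hx'.1

end Moments

/-! ### Curves are determined by their velocity -/

section Uniqueness

variable {E : Type*} [NormedAddCommGroup E] [NormedSpace ℝ E] [CompleteSpace E]
  {H : Type*} [TopologicalSpace H] {I : ModelWithCorners ℝ E H}

theorem eq_of_hasDerivAt_zero_off_finset {f : ℝ → E} {F : Finset ℝ} {a b : ℝ}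
    (hc : ContinuousOn f (uIcc a b))
    (h : ∀ t ∈ uIcc a b, t ∉ F → HasDerivAt f 0 t) : f b = f a := by
  have := integral_eq_of_hasDerivAt_off_countable f (fun _ => 0) (a := a) (b := b)
    F.countable_toSet hc (fun x hx => h x (Ioo_subset_Icc_self hx.1) hx.2) (by simp)
  simpa [eq_comm, sub_eq_zero] using this

theorem eq_of_hasMFDerivAt_zero {M : Type*} [TopologicalSpace M] [ChartedSpace H M]
    [I.Boundaryless] [IsManifold I 1 M] {δ : ℝ → M} {F : Finset ℝ} (hc : Continuous δ)
    (h : ∀ t, t ∉ F → HasMFDerivAt 𝓘(ℝ, ℝ) I δ t (0 : ℝ →L[ℝ] E)) (a b : ℝ) : δ a = δ b := by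
  have hl : IsLocallyConstant δ := by
    rw [IsLocallyConstant.iff_eventually_eq]
    intro t
    have hs : δ ⁻¹' (extChartAt I (δ t)).source ∈ 𝓝 t :=
      hc.continuousAt.preimage_mem_nhds (extChartAt_source_mem_nhds (δ t))
    obtain ⟨ε, hε, hball⟩ := Metric.mem_nhds_iff.1 hs
    filter_upwards [Metric.ball_mem_nhds t hε] with s hs
    have hsub : uIcc t s ⊆ δ ⁻¹' (extChartAt I (δ t)).source := by
      refine Subset.trans ?_ hball
      rw [← segment_eq_uIcc]
      exact (convex_ball t ε).segment_subset (Metric.mem_ball_self hε) hs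
    refine (extChartAt I (δ t)).injOn (hsub right_mem_uIcc) (hsub left_mem_uIcc) ?_
    refine eq_of_hasDerivAt_zero_off_finset (F := F) (f := fun x => extChartAt I (δ t) (δ x))
      ((continuousOn_extChartAt (δ t)).comp hc.continuousOn hsub) fun x hx hxF => ?_
    have hx' : δ x ∈ (chartAt H (δ t)).source := by
      rw [← extChartAt_source I]; exact hsub hx
    have h1 : MDifferentiableAt I 𝓘(ℝ, E) (extChartAt I (δ t)) (δ x) :=
      mdifferentiableAt_extChartAt hx'
    have h2 : HasFDerivAt (fun x => extChartAt I (δ t) (δ x)) (0 : ℝ →L[ℝ] E) x :=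
      ((h1.hasMFDerivAt.comp x (h x hxF)).congr_mfderiv
        (ContinuousLinearMap.comp_zero _)).hasFDerivAt
    simpa using h2.hasDerivAt
  exact hl.apply_eq_of_isPreconnected isPreconnected_univ (mem_univ _) (mem_univ _)

variable {G : Type*} [TopologicalSpace G] [ChartedSpace H G] [Group G] [LieGroup I ∞ G]

omit [CompleteSpace E] in
theorem hasMFDerivAt_mul_inv_zero {α β : ℝ → G} {t : ℝ}
    (hα : MDifferentiableAt 𝓘(ℝ, ℝ) I α t) (hβ : MDifferentiableAt 𝓘(ℝ, ℝ) I β t)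
    (h : modelVelocity I α t = modelVelocity I β t) :
    HasMFDerivAt 𝓘(ℝ, ℝ) I (fun s => α s * (β s)⁻¹) t (0 : ℝ →L[ℝ] E) := by
  have hd : ∀ {γ : ℝ → G}, MDifferentiableAt 𝓘(ℝ, ℝ) I γ t →
      HasMFDerivAt 𝓘(ℝ, ℝ) I (fun s => (γ t)⁻¹ * γ s) t
        (ContinuousLinearMap.toSpanSingleton ℝ (modelVelocity I γ t) : ℝ →L[ℝ] E) := by
    intro γ hγ
    have h2 : MDifferentiableAt 𝓘(ℝ, ℝ) I (fun s => (γ t)⁻¹ * γ s) t :=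
      MDifferentiableAt.comp t (mdifferentiable_mulLeft (I := I) _ _) hγ
    refine h2.hasMFDerivAt.congr_mfderiv ?_
    refine ContinuousLinearMap.ext_ring ?_
    refine (leftVelocity_eq hγ).symm.trans ?_
    exact (one_smul ℝ (modelVelocity I γ t)).symm
  have hA := hd hα
  have hB := hd hβ
  rw [← h] at hB
  set v := modelVelocity I α t
  have hM : MDifferentiable (I.prod I) I fun p : G × G => p.1 * p.2⁻¹ :=
    (contMDiff_fst.mul contMDiff_snd.inv :
      ContMDiff (I.prod I) I ∞ fun p : G × G => p.1 * p.2⁻¹).mdifferentiable (by simp)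
  have hAA := (hM ((α t)⁻¹ * α t, (α t)⁻¹ * α t)).hasMFDerivAt.comp t (hA.prodMk hA)
  have hAB := (hM ((α t)⁻¹ * α t, (β t)⁻¹ * β t)).hasMFDerivAt.comp t (hA.prodMk hB)
  have h0 : HasMFDerivAt 𝓘(ℝ, ℝ) I ((fun p : G × G => p.1 * p.2⁻¹) ∘
      fun s => ((α t)⁻¹ * α s, (α t)⁻¹ * α s)) t (0 : ℝ →L[ℝ] E) := by
    have : ((fun p : G × G => p.1 * p.2⁻¹) ∘ fun s => ((α t)⁻¹ * α s, (α t)⁻¹ * α s)) =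
        fun _ => (1 : G) := by funext s; simp
    rw [this]
    exact hasMFDerivAt_const 1 t
  have hz := hasMFDerivAt_unique hAA h0
  have hAB0 : HasMFDerivAt 𝓘(ℝ, ℝ) I ((fun p : G × G => p.1 * p.2⁻¹) ∘
      fun s => ((α t)⁻¹ * α s, (β t)⁻¹ * β s)) t (0 : ℝ →L[ℝ] E) := by
    have hpq : ∀ p q : G × G, p = q →
        (mfderiv (I.prod I) I (fun p : G × G => p.1 * p.2⁻¹) p : E × E →L[ℝ] E) =
          (mfderiv (I.prod I) I (fun p : G × G => p.1 * p.2⁻¹) q : E × E →L[ℝ] E) := by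
      rintro p q rfl; rfl
    refine hAB.congr_mfderiv (Eq.trans ?_ hz)
    exact congrArg (fun T : E × E →L[ℝ] E => T.comp
      ((ContinuousLinearMap.toSpanSingleton ℝ v).prod (ContinuousLinearMap.toSpanSingleton ℝ v)))
      (hpq _ _ (by simp))
  have hR : MDifferentiable I I fun x : G => α t * x * (β t)⁻¹ :=
    ((contMDiff_const.mul contMDiff_id).mul contMDiff_const :
      ContMDiff I I ∞ fun x : G => α t * x * (β t)⁻¹).mdifferentiable (by simp)
  have hF := (hR _).hasMFDerivAt.comp t hAB0
  have e : (fun x : G => α t * x * (β t)⁻¹) ∘ ((fun p : G × G => p.1 * p.2⁻¹) ∘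
      fun s => ((α t)⁻¹ * α s, (β t)⁻¹ * β s)) = fun s => α s * (β s)⁻¹ := by
    funext s; simp [mul_assoc]
  rw [e] at hF
  exact hF.congr_mfderiv (ContinuousLinearMap.comp_zero _)

/-- Two paths with the same starting point and the same left velocity, off a finite set of times,
are equal. -/
theorem PathSpace.eq_of_modelVelocity_eq [I.Boundaryless] {α β : PathSpace I G}
    (h0 : α.toFun 0 = β.toFun 0) {F : Finset ℝ}
    (h : EqOn (modelVelocity I α.extend) (modelVelocity I β.extend) (Ioo 0 1 \ F)) : α = β := by
  classical
  have : IsTopologicalGroup G := topologicalGroup_of_lieGroup I ∞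
  have : IsManifold I 1 G := IsManifold.of_le (n := ∞) (by simp)
  obtain ⟨A, hA, -⟩ := α.piecewise.exists_finset
  obtain ⟨B, hB, -⟩ := β.piecewise.exists_finset
  have hconst : ∀ a b, α.extend a * (β.extend a)⁻¹ = α.extend b * (β.extend b)⁻¹ := by
    refine eq_of_hasMFDerivAt_zero (I := I) (F := F ∪ A ∪ B ∪ {0, 1})
      (α.continuous_extend.mul β.continuous_extend.inv) fun t ht => ?_
    simp only [Finset.mem_union, not_or, Finset.mem_insert, Finset.mem_singleton] at ht
    obtain ⟨⟨⟨hF, hA'⟩, hB'⟩, ht0, ht1⟩ := ht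
    rcases lt_or_gt_of_ne ht0 with hlt | hgt
    · refine (hasMFDerivAt_const (α.toFun 0 * (β.toFun 0)⁻¹) t).congr_of_eventuallyEq ?_
      filter_upwards [Iio_mem_nhds hlt] with s hs
      simp only [PathSpace.extend]
      rw [IccExtend_of_le_left _ _ (le_of_lt hs), IccExtend_of_le_left _ _ (le_of_lt hs)]
      rfl
    rcases lt_or_gt_of_ne ht1 with hlt' | hgt'
    · have hm : t ∈ Ioo (0 : ℝ) 1 := ⟨hgt, hlt'⟩
      exact hasMFDerivAt_mul_inv_zero (hA t ⟨hm, hA'⟩) (hB t ⟨hm, hB'⟩) (h ⟨hm, hF⟩)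
    · refine (hasMFDerivAt_const (α.toFun 1 * (β.toFun 1)⁻¹) t).congr_of_eventuallyEq ?_
      filter_upwards [Ioi_mem_nhds hgt'] with s hs
      simp only [PathSpace.extend]
      rw [IccExtend_of_right_le _ _ (le_of_lt hs), IccExtend_of_right_le _ _ (le_of_lt hs)]
      rfl
  have h1 : α.extend 0 * (β.extend 0)⁻¹ = 1 := by
    simp only [PathSpace.extend, IccExtend_left]
    exact mul_inv_eq_one.2 h0
  refine PathSpace.ext fun t => ?_
  have h2 := mul_inv_eq_one.1 ((hconst t 0).trans h1)
  simpa [PathSpace.extend] using h2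

end Uniqueness

/-! ### The signature determines the velocity moments -/

section SignatureMoments

variable {E : Type*} [NormedAddCommGroup E] [NormedSpace ℝ E] [FiniteDimensional ℝ E]
  {H : Type*} [TopologicalSpace H] {I : ModelWithCorners ℝ E H}
  {G : Type*} [TopologicalSpace G] [ChartedSpace H G] [Group G]
  {ι : Type*} (b : Module.Basis ι ℝ (GroupLieAlgebra I G)) (γ : PathSpace I G)

theorem PathSpace.intervalIntegrable_linear (l : GroupLieAlgebra I G →ₗ[ℝ] ℝ) :
    IntervalIntegrable (fun s => l (leftVelocity I γ.extend s)) volume 0 1 := by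
  let l' : E →L[ℝ] ℝ := LinearMap.toContinuousLinearMap (E := E) l
  have h : IntervalIntegrable (modelVelocity I γ.extend) volume 0 1 :=
    γ.piecewise.intervalIntegrable_modelVelocity
  rw [intervalIntegrable_iff] at h ⊢
  exact l'.integrable_comp h

theorem continuousOn_iteratedIntegral (m : ℕ) (J : Fin m → ι) :
    ContinuousOn (iteratedIntegral b γ m J) (Icc 0 1) := by
  induction m with
  | zero => exact continuousOn_const
  | succ m ih =>
    have h : IntervalIntegrable (fun s => iteratedIntegral b γ m (Fin.init J) s *
        b.coord (J (Fin.last m)) (leftVelocity I γ.extend s)) volume 0 1 := by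
      refine (γ.intervalIntegrable_linear _).continuousOn_mul ?_
      rw [uIcc_of_le zero_le_one]
      exact ih _
    have h2 := intervalIntegral.continuousOn_primitive_interval
      ((intervalIntegrable_iff' (μ := volume)).1 h)
    rwa [uIcc_of_le zero_le_one] at h2

theorem intervalIntegrable_iteratedIntegral_mul (m : ℕ) (J : Fin m → ι)
    (l : GroupLieAlgebra I G →ₗ[ℝ] ℝ) {t : ℝ} (ht : t ∈ Icc (0 : ℝ) 1) :
    IntervalIntegrable (fun s => iteratedIntegral b γ m J s * l (leftVelocity I γ.extend s))
      volume 0 t := by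
  refine IntervalIntegrable.mono_set (a := 0) (b := 1) ?_ ?_
  · refine (γ.intervalIntegrable_linear _).continuousOn_mul ?_
    rw [uIcc_of_le zero_le_one]
    exact continuousOn_iteratedIntegral b γ m J
  · rw [uIcc_of_le zero_le_one, uIcc_of_le ht.1]
    exact Icc_subset_Icc_right ht.2

variable [Fintype ι]

theorem sum_iteratedIntegral_succ {m : ℕ} (c : (Fin m → ι) → ℝ)
    (l : GroupLieAlgebra I G →ₗ[ℝ] ℝ) {t : ℝ} (ht : t ∈ Icc (0 : ℝ) 1) :
    ∑ J : Fin (m + 1) → ι, c (Fin.init J) * l (b (J (Fin.last m))) *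
        iteratedIntegral b γ (m + 1) J t =
      ∫ s in (0 : ℝ)..t, (∑ J : Fin m → ι, c J * iteratedIntegral b γ m J s) *
        l (leftVelocity I γ.extend s) := by
  simp only [iteratedIntegral, ← intervalIntegral.integral_const_mul]
  rw [← intervalIntegral.integral_finsetSum fun J _ =>
    (intervalIntegrable_iteratedIntegral_mul b γ m _ _ ht).const_mul _]
  congr 1
  funext s
  rw [← (Fin.snocEquiv fun _ => ι).sum_comp, Fintype.sum_prod_type]
  simp only [Fin.snocEquiv, Equiv.coe_fn_mk, Fin.init_snoc, Fin.snoc_last]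
  have hl : l (leftVelocity I γ.extend s) =
      ∑ i, l (b i) * b.coord i (leftVelocity I γ.extend s) := by
    conv_lhs => rw [← b.sum_repr (leftVelocity I γ.extend s)]
    simp only [map_sum, map_smul, smul_eq_mul, Module.Basis.coord_apply, mul_comm]
  rw [hl, Finset.sum_mul_sum, Finset.sum_comm]
  refine Finset.sum_congr rfl fun J _ => Finset.sum_congr rfl fun i _ => ?_
  ring

/-- If the linear form `τ` is `1` on the velocity, then the iterated integrals of `τ` are those of
the time. -/
theorem sum_prod_iteratedIntegral {τ : GroupLieAlgebra I G →ₗ[ℝ] ℝ}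
    (hτ : ∀ᵐ s, s ∈ Ioo (0 : ℝ) 1 → τ (leftVelocity I γ.extend s) = 1) (m : ℕ) {t : ℝ}
    (ht : t ∈ Icc (0 : ℝ) 1) :
    ∑ J : Fin m → ι, (∏ k, τ (b (J k))) * iteratedIntegral b γ m J t = t ^ m / m.factorial := by
  induction m generalizing t with
  | zero => simp [iteratedIntegral]
  | succ m ih =>
    have h := sum_iteratedIntegral_succ b γ (fun J : Fin m → ι => ∏ k, τ (b (J k))) τ ht
    simp only [Fin.prod_univ_castSucc]
    refine h.trans ?_
    have h2 : ∫ s in (0 : ℝ)..t, (∑ J : Fin m → ι, (∏ k, τ (b (J k))) *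
          iteratedIntegral b γ m J s) * τ (leftVelocity I γ.extend s) =
        ∫ s in (0 : ℝ)..t, s ^ m / m.factorial := by
      rw [intervalIntegral.integral_of_le ht.1, intervalIntegral.integral_of_le ht.1,
        integral_Ioc_eq_integral_Ioo, integral_Ioc_eq_integral_Ioo]
      refine integral_congr_ae ((ae_restrict_iff' measurableSet_Ioo).2 ?_)
      filter_upwards [hτ] with s hs hst
      have hs' : s ∈ Ioo (0 : ℝ) 1 := ⟨hst.1, hst.2.trans_le ht.2⟩
      rw [hs hs', mul_one, ih ⟨hs'.1.le, hs'.2.le⟩]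
    rw [h2, intervalIntegral.integral_div, integral_pow]
    simp only [ne_eq, Nat.succ_ne_zero, not_false_eq_true, zero_pow, sub_zero]
    rw [Nat.factorial_succ, div_div]
    push_cast
    rfl

omit [FiniteDimensional ℝ E] in
theorem lift_signature (m : ℕ) (l : Fin m → GroupLieAlgebra I G →ₗ[ℝ] ℝ) :
    PiTensorProduct.lift ((MultilinearMap.mkPiAlgebra ℝ (Fin m) ℝ).compLinearMap l)
        (signature b γ m) =
      ∑ J : Fin m → ι, (∏ k, l k (b (J k))) * iteratedIntegral b γ m J 1 := by
  simp [signature, mul_comm]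

theorem moment_eq_lift_signature {τ : GroupLieAlgebra I G →ₗ[ℝ] ℝ}
    (hτ : ∀ᵐ s, s ∈ Ioo (0 : ℝ) 1 → τ (leftVelocity I γ.extend s) = 1) (m : ℕ)
    (l : GroupLieAlgebra I G →ₗ[ℝ] ℝ) :
    ∫ s in (0 : ℝ)..1, s ^ m * l (leftVelocity I γ.extend s) =
      m.factorial * PiTensorProduct.lift ((MultilinearMap.mkPiAlgebra ℝ (Fin (m + 1)) ℝ).compLinearMap
        (Fin.snoc (fun _ => τ) l)) (signature b γ (m + 1)) := by
  rw [lift_signature]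
  simp only [Fin.prod_univ_castSucc, Fin.snoc_castSucc, Fin.snoc_last]
  have h := sum_iteratedIntegral_succ b γ (fun J : Fin m → ι => ∏ k, τ (b (J k))) l
    (right_mem_Icc.2 zero_le_one)
  refine Eq.trans ?_ (congrArg (fun x : ℝ => m.factorial * x) h.symm)
  rw [← intervalIntegral.integral_const_mul]
  refine intervalIntegral.integral_congr fun s hs => ?_
  rw [uIcc_of_le zero_le_one] at hs
  simp only [sum_prod_iteratedIntegral b γ hτ m hs]
  field_simp

variable {γ} [LieGroup I ∞ G] [I.Boundaryless]

/-- The signature is injective on the paths from a given point along which a linear form takes the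
value `1` on the velocity. -/
theorem PathSpace.eq_of_signature_eq {δ : PathSpace I G} (h0 : γ.toFun 0 = δ.toFun 0)
    {τ : GroupLieAlgebra I G →ₗ[ℝ] ℝ}
    (hγ : ∀ᵐ s, s ∈ Ioo (0 : ℝ) 1 → τ (leftVelocity I γ.extend s) = 1)
    (hδ : ∀ᵐ s, s ∈ Ioo (0 : ℝ) 1 → τ (leftVelocity I δ.extend s) = 1)
    (h : signature b γ = signature b δ) : γ = δ := by
  classical
  have : CompleteSpace E := FiniteDimensional.complete ℝ E
  obtain ⟨A, -, hA⟩ := γ.piecewise.exists_finset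
  obtain ⟨B, -, hB⟩ := δ.piecewise.exists_finset
  have hγi : IntervalIntegrable (modelVelocity I γ.extend) volume 0 1 :=
    γ.piecewise.intervalIntegrable_modelVelocity
  have hδi : IntervalIntegrable (modelVelocity I δ.extend) volume 0 1 :=
    δ.piecewise.intervalIntegrable_modelVelocity
  have hm : ∀ (m : ℕ), ∫ s in (0 : ℝ)..1,
      s ^ m • (modelVelocity I γ.extend s - modelVelocity I δ.extend s) = 0 := by
    intro m
    have hpow : ContinuousOn (fun s : ℝ => s ^ m) (uIcc 0 1) := by fun_prop
    refine SeparatingDual.eq_zero_of_forall_dual_eq_zero (R := ℝ) fun l => ?_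
    rw [← l.intervalIntegral_comp_comm ((hγi.sub hδi).continuousOn_smul hpow)]
    simp only [map_smul, map_sub, smul_eq_mul, mul_sub]
    have e1 := moment_eq_lift_signature b γ hγ m (l : E →ₗ[ℝ] ℝ)
    have e2 := moment_eq_lift_signature b δ hδ m (l : E →ₗ[ℝ] ℝ)
    rw [h, ← e2] at e1
    rw [intervalIntegral.integral_sub]
    · exact sub_eq_zero.2 e1
    · exact (γ.intervalIntegrable_linear (l : E →ₗ[ℝ] ℝ)).continuousOn_mul hpow
    · exact (δ.intervalIntegrable_linear (l : E →ₗ[ℝ] ℝ)).continuousOn_mul hpow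
  refine PathSpace.eq_of_modelVelocity_eq h0 (F := A ∪ B) fun s hs => sub_eq_zero.1 ?_
  refine eqOn_zero_of_moments (hγi.sub hδi) (F := A ∪ B) (ContinuousOn.sub (hA.mono ?_)
    (hB.mono ?_)) hm hs
  · exact fun x hx => ⟨hx.1, fun h => hx.2 (by simp [Finset.mem_coe.1 h])⟩
  · exact fun x hx => ⟨hx.1, fun h => hx.2 (by simp [Finset.mem_coe.1 h])⟩

end SignatureMoments

section TimePath

variable {E : Type*} [NormedAddCommGroup E] [NormedSpace ℝ E]
  {H : Type*} [TopologicalSpace H] {I : ModelWithCorners ℝ E H}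
  {G : Type*} [TopologicalSpace G] [ChartedSpace H G] [Group G]

variable (I G) in
/-- The differential of the projection `G × ℝ → ℝ`. -/
def timeForm : GroupLieAlgebra (I.prod 𝓘(ℝ, ℝ)) (G × Multiplicative ℝ) →ₗ[ℝ] ℝ :=
  LinearMap.snd ℝ E ℝ

variable [LieGroup I ∞ G]

theorem timeForm_leftVelocity_timePath (γ : BasedPathSpace I G) : ∀ᵐ s, s ∈ Ioo (0 : ℝ) 1 →
    timeForm I G (leftVelocity (I.prod 𝓘(ℝ, ℝ)) (timePath γ).extend s) = 1 := by
  obtain ⟨F, hF, -⟩ := γ.1.piecewise.exists_finset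
  have hFc : ∀ᵐ s : ℝ, s ∉ (F : Set ℝ) := F.countable_toSet.ae_notMem _
  filter_upwards [hFc] with s hs hs'
  refine congrArg Prod.snd (leftVelocity_time (hF s ⟨hs', hs⟩) ?_).2
  filter_upwards [Ioo_mem_nhds hs'.1 hs'.2] with t ht
  rw [PathSpace.extend, IccExtend_of_mem _ _ ⟨ht.1.le, ht.2.le⟩,
    IccExtend_of_mem _ _ ⟨ht.1.le, ht.2.le⟩]
  rfl

theorem timePath_injective : Function.Injective (timePath (I := I) (G := G)) := by
  intro α β h
  refine Subtype.ext (PathSpace.ext fun t => ?_)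
  exact congrArg Prod.fst (congrFun (congrArg PathSpace.toFun h) t)

theorem signature_timePath_injective [FiniteDimensional ℝ E] [I.Boundaryless]
    {ι : Type*} [Fintype ι]
    (b : Module.Basis ι ℝ (GroupLieAlgebra (I.prod 𝓘(ℝ, ℝ)) (G × Multiplicative ℝ))) :
    Function.Injective (signature b ∘ timePath (I := I) (G := G)) := by
  intro α β h
  refine timePath_injective (PathSpace.eq_of_signature_eq b ?_
    (timeForm_leftVelocity_timePath α) (timeForm_leftVelocity_timePath β) h)
  exact Prod.ext (α.2.trans β.2.symm) rfl

theorem idInit_injective [FiniteDimensional ℝ E] [I.Boundaryless] [T2Space G]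
    {log : G → GroupLieAlgebra I G} (hlog : ∀ g, lieExp (log g) = g) :
    Function.Injective (idInit log : PathSpace I G → BasedPathSpace I G) := by
  have key : ∀ (γ : PathSpace I G) (t : unitInterval),
      γ.toFun t = (idInit log γ).1.toFun ⟨((t : ℝ) + 1) / 2,
        by linarith [t.2.1], by linarith [t.2.2]⟩ := by
    intro γ t
    change _ = if ((t : ℝ) + 1) / 2 < 1 / 2 then _ else
      lieExp ((1 : ℝ) • log (γ.toFun 0)) * (γ.toFun 0)⁻¹ * γ.extend (2 * (((t : ℝ) + 1) / 2) - 1)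
    rw [if_neg (by linarith [t.2.1]), one_smul, hlog, mul_inv_cancel, one_mul,
      mul_div_cancel₀ _ two_ne_zero, add_sub_cancel_right, PathSpace.extend, IccExtend_val]
  intro α β h
  exact PathSpace.ext fun t => by rw [key α, key β, h]

end TimePath

/-! ### Change of variables under an increasing bijection -/

section ChangeOfVariables

theorem setIntegral_eq_withDensity_sub {α : Type*} [MeasurableSpace α] {μ : Measure α}
    {p : α → ℝ} (hp : Integrable p μ) {s : Set α} (hs : MeasurableSet s) :
    ∫ x in s, p x ∂μ = (μ.withDensity (fun x => ENNReal.ofReal (p x)) s).toReal -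
      (μ.withDensity (fun x => ENNReal.ofReal (-p x)) s).toReal := by
  rw [withDensity_apply _ hs, withDensity_apply _ hs]
  exact integral_eq_lintegral_pos_part_sub_lintegral_neg_part hp.integrableOn

theorem isFiniteMeasure_withDensity_ofReal_of_integrable {α : Type*} [MeasurableSpace α]
    {μ : Measure α} {p : α → ℝ} (hp : Integrable p μ) :
    IsFiniteMeasure (μ.withDensity fun x => ENNReal.ofReal (p x)) :=
  isFiniteMeasure_withDensity_ofReal hp.2

theorem integral_mul_eq_withDensity_sub {g p : unitInterval → ℝ} (hg : Continuous g)
    (hp : Integrable p) :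
    ∫ x, g x * p x = (∫ x, g x ∂volume.withDensity fun x => ENNReal.ofReal (p x)) -
      ∫ x, g x ∂volume.withDensity fun x => ENNReal.ofReal (-p x) := by
  obtain ⟨C, hC⟩ := isCompact_univ.exists_bound_of_continuousOn hg.continuousOn
  have hgb : ∀ᵐ x, ‖g x‖ ≤ C := Eventually.of_forall fun x => hC x (mem_univ x)
  have hgm := hg.aestronglyMeasurable (μ := (volume : Measure unitInterval))
  have hpn : AEMeasurable fun x => ENNReal.ofReal (-p x) := hp.neg.aemeasurable.ennreal_ofReal
  rw [integral_withDensity_eq_integral_toReal_smul₀ hp.aemeasurable.ennreal_ofReal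
      (Eventually.of_forall fun _ => ENNReal.ofReal_lt_top),
    integral_withDensity_eq_integral_toReal_smul₀ hpn
      (Eventually.of_forall fun _ => ENNReal.ofReal_lt_top), ← integral_sub]
  · refine integral_congr_ae (Eventually.of_forall fun x => ?_)
    simp only [ENNReal.toReal_ofReal', smul_eq_mul, ← sub_mul]
    rw [mul_comm]
    congr 1
    rcases le_total (p x) 0 with h | h
    · rw [max_eq_right h, max_eq_left (by linarith)]; ring
    · rw [max_eq_left h, max_eq_right (by linarith)]; ring
  · simp only [ENNReal.toReal_ofReal']
    exact hp.pos_part.mul_bdd hgm hgb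
  · simp only [ENNReal.toReal_ofReal']
    exact hp.neg_part.mul_bdd hgm hgb

/-- Change of variables for densities whose primitives correspond under `φ`. -/
theorem integral_comp_orderIso {p q : unitInterval → ℝ} (hp : Integrable p) (hq : Integrable q)
    (φ : unitInterval ≃o unitInterval)
    (h : ∀ t, ∫ s in Iic t, p s = ∫ s in Iic (φ t), q s) {g : unitInterval → ℝ}
    (hg : Continuous g) : ∫ t, g (φ t) * p t = ∫ t, g t * q t := by
  have hφ : Continuous φ := φ.continuous
  have hφm : Measurable φ := hφ.measurable
  rw [integral_mul_eq_withDensity_sub (g := fun t => g (φ t)) (hg.comp hφ) hp,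
    integral_mul_eq_withDensity_sub hg hq]
  have := isFiniteMeasure_withDensity_ofReal_of_integrable hp
  have := isFiniteMeasure_withDensity_ofReal_of_integrable hq
  have : IsFiniteMeasure (volume.withDensity fun x => ENNReal.ofReal (-p x)) :=
    isFiniteMeasure_withDensity_ofReal_of_integrable hp.neg
  have : IsFiniteMeasure (volume.withDensity fun x => ENNReal.ofReal (-q x)) :=
    isFiniteMeasure_withDensity_ofReal_of_integrable hq.neg
  have hI := fun t => setIntegral_eq_withDensity_sub hp (measurableSet_Iic (a := t))
  have hI' := fun t => setIntegral_eq_withDensity_sub hq (measurableSet_Iic (a := t))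
  set P := (volume : Measure unitInterval).withDensity fun x => ENNReal.ofReal (p x)
  set N := (volume : Measure unitInterval).withDensity fun x => ENNReal.ofReal (-p x)
  set P' := (volume : Measure unitInterval).withDensity fun x => ENNReal.ofReal (q x)
  set N' := (volume : Measure unitInterval).withDensity fun x => ENNReal.ofReal (-q x)
  have hmeas : P.map φ + N' = N.map φ + P' := by
    refine Measure.ext_of_Iic _ _ fun a => ?_
    have ha : φ ⁻¹' Iic a = Iic (φ.symm a) := by
      ext x; exact (φ.le_symm_apply).symm
    rw [Measure.add_apply, Measure.add_apply, Measure.map_apply hφm measurableSet_Iic,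
      Measure.map_apply hφm measurableSet_Iic, ha]
    have h1 := h (φ.symm a)
    rw [φ.apply_symm_apply, hI, hI'] at h1
    rw [← ENNReal.toReal_eq_toReal_iff' (by finiteness) (by finiteness),
      ENNReal.toReal_add (by finiteness) (by finiteness),
      ENNReal.toReal_add (by finiteness) (by finiteness)]
    linarith
  have hgi : ∀ (μ : Measure unitInterval) [IsFiniteMeasure μ], Integrable g μ := fun μ _ =>
    hg.integrable_of_hasCompactSupport (HasCompactSupport.of_compactSpace g)
  have h2 : ∫ x, g x ∂(P.map φ + N') = ∫ x, g x ∂(N.map φ + P') := by rw [hmeas]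
  rw [integral_add_measure (hgi _) (hgi _), integral_add_measure (hgi _) (hgi _),
    integral_map hφm.aemeasurable hg.aestronglyMeasurable,
    integral_map hφm.aemeasurable hg.aestronglyMeasurable] at h2
  linarith

theorem setIntegral_unitInterval_Iic (p : ℝ → ℝ) (t : unitInterval) :
    ∫ s : unitInterval in Iic t, p s = ∫ s in (0 : ℝ)..t, p s := by
  have h := unitInterval.measurePreserving_coe.setIntegral_preimage_emb
    unitInterval.measurableEmbedding_coe p (Iic (t : ℝ))
  have e : (Subtype.val : unitInterval → ℝ) ⁻¹' Iic (t : ℝ) = Iic t := rfl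
  rw [e] at h
  rw [h, Measure.restrict_restrict measurableSet_Iic, intervalIntegral.integral_of_le t.2.1,
    ← integral_Icc_eq_integral_Ioc]
  congr 2
  ext x
  exact ⟨fun hx => ⟨hx.2.1, hx.1⟩, fun hx => ⟨hx.2, hx.1, hx.2.trans t.2.2⟩⟩

theorem integral_unitInterval (p : ℝ → ℝ) : ∫ s : unitInterval, p s = ∫ s in (0 : ℝ)..1, p s := by
  have h := setIntegral_unitInterval_Iic p 1
  have e : Iic (1 : unitInterval) = univ := Iic_top
  rwa [e, setIntegral_univ] at h

theorem integrable_unitInterval {p : ℝ → ℝ} (hp : IntervalIntegrable p volume 0 1) :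
    Integrable fun s : unitInterval => p s :=
  (integrableOn_iff_comap_subtypeVal measurableSet_Icc).1
    ((intervalIntegrable_iff_integrableOn_Icc_of_le zero_le_one).1 hp)

end ChangeOfVariables

/-! ### Integrals of functions along a path -/

section PathIntegral

variable {E : Type*} [NormedAddCommGroup E] [NormedSpace ℝ E]
  {H : Type*} [TopologicalSpace H] {I : ModelWithCorners ℝ E H}
  {G : Type*} [TopologicalSpace G] [ChartedSpace H G] [Group G]

/-- The integral of `f(γ_0⁻¹ γ_t) θ(γ'_t)` over `[0, 1]`. -/
noncomputable def pathIntegral (θ : GroupLieAlgebra I G →ₗ[ℝ] ℝ) (f : G → ℝ)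
    (γ : PathSpace I G) : ℝ :=
  ∫ s in (0 : ℝ)..1, f ((γ.toFun 0)⁻¹ * γ.extend s) * θ (leftVelocity I γ.extend s)

/-- The displacement `γ_0⁻¹ γ_1`. -/
def displacement (γ : PathSpace I G) : G := (γ.toFun 0)⁻¹ * γ.toFun 1

variable [LieGroup I ∞ G] (θ : GroupLieAlgebra I G →ₗ[ℝ] ℝ)

namespace PathSpace

theorem concat_toFun_zero (α β : PathSpace I G) : (α.concat β).toFun 0 = α.toFun 0 := by
  change (if (0 : ℝ) < 1 / 2 then α.extend (2 * (0 : ℝ)) else _) = _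
  rw [if_pos (by norm_num), mul_zero, extend, IccExtend_left]
  rfl

theorem concat_toFun_one (α β : PathSpace I G) :
    (α.concat β).toFun 1 = α.toFun 1 * (β.toFun 0)⁻¹ * β.toFun 1 := by
  change (if (1 : ℝ) < 1 / 2 then _ else
    α.toFun 1 * (β.toFun 0)⁻¹ * β.extend (2 * (1 : ℝ) - 1)) = _
  rw [if_neg (by norm_num), extend,
    IccExtend_of_right_le _ _ (by norm_num : (1 : ℝ) ≤ 2 * 1 - 1)]
  rfl

theorem concat_extend_left (α β : PathSpace I G) {s : ℝ} (hs : s ∈ Ioo (0 : ℝ) (1 / 2)) :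
    (α.concat β).extend s = α.extend (2 * s) := by
  rw [extend, IccExtend_of_mem _ _ ⟨hs.1.le, by linarith [hs.2]⟩]
  exact if_pos hs.2

theorem concat_extend_right (α β : PathSpace I G) {s : ℝ} (hs : s ∈ Ioo (1 / 2 : ℝ) 1) :
    (α.concat β).extend s = α.toFun 1 * (β.toFun 0)⁻¹ * β.extend (2 * s + -1) := by
  rw [extend, IccExtend_of_mem _ _ ⟨by linarith [hs.1], hs.2.le⟩]
  exact if_neg (not_lt.2 hs.1.le)

theorem reverse_toFun_zero (γ : PathSpace I G) : γ.reverse.toFun 0 = γ.toFun 1 :=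
  congrArg γ.toFun unitInterval.symm_zero

theorem reverse_toFun_one (γ : PathSpace I G) : γ.reverse.toFun 1 = γ.toFun 0 :=
  congrArg γ.toFun unitInterval.symm_one

theorem reverse_extend (γ : PathSpace I G) {s : ℝ} (hs : s ∈ Ioo (0 : ℝ) 1) :
    γ.reverse.extend s = γ.extend (-1 * s + 1) := by
  rw [extend, extend, IccExtend_of_mem _ _ ⟨hs.1.le, hs.2.le⟩,
    IccExtend_of_mem _ _ ⟨by linarith [hs.2], by linarith [hs.1]⟩]
  refine congrArg γ.toFun (Subtype.ext ?_)
  rw [unitInterval.coe_symm_eq]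
  ring

end PathSpace

theorem displacement_concat (α β : PathSpace I G) :
    displacement (α.concat β) = displacement α * displacement β := by
  simp only [displacement, PathSpace.concat_toFun_zero, PathSpace.concat_toFun_one, mul_assoc]

theorem displacement_reverse (γ : PathSpace I G) :
    displacement γ.reverse = (displacement γ)⁻¹ := by
  simp [displacement, PathSpace.reverse_toFun_zero, PathSpace.reverse_toFun_one]

theorem displacement_const (g : G) : displacement (PathSpace.const g : PathSpace I G) = 1 :=
  inv_mul_cancel g

theorem pathIntegral_const (f : G → ℝ) (g : G) :
    pathIntegral θ f (PathSpace.const g : PathSpace I G) = 0 := by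
  have h : ∀ s, leftVelocity I (PathSpace.const g : PathSpace I G).extend s = 0 := fun s => by
    have e : (PathSpace.const g : PathSpace I G).extend = fun _ => g := rfl
    rw [e]
    unfold leftVelocity
    rw [mfderiv_const]
    exact map_zero (mfderiv I I (fun x : G => g⁻¹ * x) g)
  simp [pathIntegral, h]

theorem pathIntegral_reverse (f : G → ℝ) (γ : PathSpace I G) :
    pathIntegral θ f γ.reverse =
      -pathIntegral θ (fun x => f ((displacement γ)⁻¹ * x)) γ := by
  unfold pathIntegral
  have h1 := intervalIntegral.mul_integral_comp_mul_add (a := 0) (b := 1)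
    (f := fun s => f ((displacement γ)⁻¹ * ((γ.toFun 0)⁻¹ * γ.extend s)) *
      θ (leftVelocity I γ.extend s)) (-1) 1
  simp only [mul_zero, zero_add, mul_one, neg_add_cancel] at h1
  rw [intervalIntegral.integral_symm 0 1, neg_one_mul, neg_inj] at h1
  rw [← h1, ← intervalIntegral.integral_neg]
  refine intervalIntegral.integral_congr_Ioo_of_le zero_le_one fun s hs => ?_
  have e : γ.reverse.extend =ᶠ[𝓝 s] fun s => (1 : G) * γ.extend (-1 * s + 1) := by
    filter_upwards [Ioo_mem_nhds hs.1 hs.2] with x hx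
    rw [one_mul, γ.reverse_extend hx]
  rw [leftVelocity_affine (by norm_num) e, γ.reverse_extend hs, PathSpace.reverse_toFun_zero]
  simp [displacement, mul_assoc]

variable [FiniteDimensional ℝ E]

theorem intervalIntegrable_pathIntegral {f : G → ℝ} (hf : Continuous f) (γ : PathSpace I G) :
    IntervalIntegrable (fun s => f ((γ.toFun 0)⁻¹ * γ.extend s) *
      θ (leftVelocity I γ.extend s)) volume 0 1 := by
  have : IsTopologicalGroup G := topologicalGroup_of_lieGroup I ∞
  exact (γ.intervalIntegrable_linear θ).continuousOn_mul
    (hf.comp (continuous_const.mul γ.continuous_extend)).continuousOn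

theorem pathIntegral_concat {f : G → ℝ} (hf : Continuous f) (α β : PathSpace I G) :
    pathIntegral θ f (α.concat β) =
      pathIntegral θ f α + pathIntegral θ (fun x => f (displacement α * x)) β := by
  have hi := intervalIntegrable_pathIntegral θ hf (α.concat β)
  have hsub : ∀ a b : ℝ, a ∈ Icc (0 : ℝ) 1 → b ∈ Icc (0 : ℝ) 1 → uIcc a b ⊆ uIcc 0 1 :=
    fun a b ha hb => by
      rw [uIcc_of_le zero_le_one]
      exact ordConnected_Icc.uIcc_subset ha hb
  have hhalf : (1 / 2 : ℝ) ∈ Icc (0 : ℝ) 1 := by norm_num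
  unfold pathIntegral
  rw [← intervalIntegral.integral_add_adjacent_intervals
    (hi.mono_set (hsub 0 (1 / 2) (left_mem_Icc.2 zero_le_one) hhalf))
    (hi.mono_set (hsub (1 / 2) 1 hhalf (right_mem_Icc.2 zero_le_one)))]
  congr 1
  · have h1 := intervalIntegral.mul_integral_comp_mul_add (a := 0) (b := 1 / 2)
      (f := fun s => f ((α.toFun 0)⁻¹ * α.extend s) * θ (leftVelocity I α.extend s)) 2 0
    norm_num only at h1
    rw [← h1, ← intervalIntegral.integral_const_mul]
    refine intervalIntegral.integral_congr_Ioo_of_le (by norm_num) fun s hs => ?_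
    have e : (α.concat β).extend =ᶠ[𝓝 s] fun s => (1 : G) * α.extend (2 * s + 0) := by
      filter_upwards [Ioo_mem_nhds hs.1 hs.2] with x hx
      rw [one_mul, add_zero, α.concat_extend_left β hx]
    rw [leftVelocity_affine two_ne_zero e, α.concat_extend_left β hs, α.concat_toFun_zero,
      map_smul, smul_eq_mul, add_zero]
    ring
  · have h1 := intervalIntegral.mul_integral_comp_mul_add (a := 1 / 2) (b := 1)
      (f := fun s => f (displacement α * ((β.toFun 0)⁻¹ * β.extend s)) *
        θ (leftVelocity I β.extend s)) 2 (-1)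
    norm_num only at h1
    rw [← h1, ← intervalIntegral.integral_const_mul]
    refine intervalIntegral.integral_congr_Ioo_of_le (by norm_num) fun s hs => ?_
    have e : (α.concat β).extend =ᶠ[𝓝 s] fun s =>
        (α.toFun 1 * (β.toFun 0)⁻¹) * β.extend (2 * s + -1) := by
      filter_upwards [Ioo_mem_nhds hs.1 hs.2] with x hx
      exact α.concat_extend_right β hx
    rw [leftVelocity_affine two_ne_zero e, α.concat_extend_right β hs, α.concat_toFun_zero,
      map_smul, smul_eq_mul]
    simp only [displacement, mul_assoc]
    ring

/-- A linear form on the Lie algebra that is exact along paths: its integral along a path is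
the increment of the function `τ`. -/
def IsExactAlongPaths (τ : G → ℝ) : Prop :=
  ∀ (γ : PathSpace I G) (t : unitInterval),
    ∫ s in (0 : ℝ)..t, θ (leftVelocity I γ.extend s) = τ (γ.toFun t) - τ (γ.toFun 0)

variable {θ} {τ : G → ℝ}

omit [LieGroup I ∞ G] [FiniteDimensional ℝ E] in
theorem IsReparametrization.displacement_eq {γ δ : PathSpace I G} (h : IsReparametrization γ δ) :
    displacement γ = displacement δ := by
  obtain ⟨φ, hφ⟩ := h
  have h0 : φ 0 = 0 := φ.map_bot
  have h1 : φ 1 = 1 := φ.map_top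
  rw [displacement, hφ, hφ, h0, h1, displacement]

theorem IsReparametrization.pathIntegral_eq (hθ : IsExactAlongPaths θ τ) {γ δ : PathSpace I G}
    (h : IsReparametrization γ δ) {f : G → ℝ} (hf : Continuous f) :
    pathIntegral θ f γ = pathIntegral θ f δ := by
  have : IsTopologicalGroup G := topologicalGroup_of_lieGroup I ∞
  obtain ⟨φ, hφ⟩ := h
  have h0 : φ 0 = 0 := φ.map_bot
  unfold pathIntegral
  rw [← integral_unitInterval, ← integral_unitInterval]
  have key := integral_comp_orderIso (integrable_unitInterval (γ.intervalIntegrable_linear θ))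
    (integrable_unitInterval (δ.intervalIntegrable_linear θ)) φ (fun t => by
      rw [setIntegral_unitInterval_Iic (fun s => θ (leftVelocity I γ.extend s)),
        setIntegral_unitInterval_Iic (fun s => θ (leftVelocity I δ.extend s)), hθ, hθ, hφ, hφ, h0])
    (g := fun s => f ((δ.toFun 0)⁻¹ * δ.toFun s))
    (hf.comp (continuous_const.mul δ.continuous_toFun))
  simp only [PathSpace.extend, IccExtend_val] at key ⊢
  rw [← key]
  simp only [hφ, h0]

/-- Equality of the displacements and of all integrals with respect to `θ`. -/
def HasSameIntegrals (θ : GroupLieAlgebra I G →ₗ[ℝ] ℝ) (γ δ : PathSpace I G) : Prop :=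
  displacement γ = displacement δ ∧
    ∀ f : G → ℝ, Continuous f → pathIntegral θ f γ = pathIntegral θ f δ

theorem Reduces.hasSameIntegrals (hθ : IsExactAlongPaths θ τ) {γ δ : PathSpace I G}
    (h : Reduces γ δ) : HasSameIntegrals θ γ δ := by
  have : IsTopologicalGroup G := topologicalGroup_of_lieGroup I ∞
  have hc : ∀ {f : G → ℝ} (g : G), Continuous f → Continuous fun x => f (g * x) :=
    fun g hf => hf.comp (continuous_const_mul g)
  cases h with
  | middle α ζ β h =>
    refine ⟨?_, fun f hf => ?_⟩
    · rw [h.displacement_eq]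
      simp [displacement_concat, displacement_reverse]
    · rw [h.pathIntegral_eq hθ hf, pathIntegral_concat θ hf, pathIntegral_concat θ hf,
        pathIntegral_concat θ hf, pathIntegral_concat θ hf, pathIntegral_reverse]
      simp [displacement_concat, displacement_reverse, mul_assoc]
  | left ζ _ h =>
    refine ⟨?_, fun f hf => ?_⟩
    · rw [h.displacement_eq]
      simp [displacement_concat, displacement_reverse]
    · rw [h.pathIntegral_eq hθ hf, pathIntegral_concat θ hf, pathIntegral_concat θ hf,
        pathIntegral_reverse]
      simp [displacement_concat, displacement_reverse]
  | right _ ζ h =>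
    refine ⟨?_, fun f hf => ?_⟩
    · rw [h.displacement_eq]
      simp [displacement_concat, displacement_reverse]
    · rw [h.pathIntegral_eq hθ hf, pathIntegral_concat θ hf, pathIntegral_concat θ hf,
        pathIntegral_reverse]
      simp [displacement_concat, mul_assoc]
  | all ζ h =>
    refine ⟨?_, fun f hf => ?_⟩
    · rw [h.displacement_eq]
      simp [displacement_concat, displacement_reverse, displacement_const]
    · rw [h.pathIntegral_eq hθ hf, pathIntegral_concat θ hf, pathIntegral_reverse,
        pathIntegral_const]
      simp

theorem IsTreeLike.hasSameIntegrals (hθ : IsExactAlongPaths θ τ) {γ : PathSpace I G}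
    (h : IsTreeLike γ) : HasSameIntegrals θ γ (PathSpace.const 1) := by
  induction h using Relation.ReflTransGen.head_induction_on with
  | refl => exact ⟨rfl, fun _ _ => rfl⟩
  | head h _ ih =>
    have h' := h.hasSameIntegrals hθ
    exact ⟨h'.1.trans ih.1, fun f hf => (h'.2 f hf).trans (ih.2 f hf)⟩

theorem TreeLikeEquiv.hasSameIntegrals (hθ : IsExactAlongPaths θ τ) {α β : PathSpace I G}
    (h : TreeLikeEquiv α β) : HasSameIntegrals θ α β := by
  obtain ⟨h1, h2⟩ := IsTreeLike.hasSameIntegrals hθ h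
  rw [displacement_concat, displacement_reverse, displacement_const, mul_inv_eq_one] at h1
  refine ⟨h1, fun f hf => ?_⟩
  have h3 := h2 f hf
  rw [pathIntegral_concat θ hf, pathIntegral_reverse, pathIntegral_const, h1] at h3
  simp only [mul_inv_cancel_left] at h3
  linarith

theorem hasSameIntegrals_of_treeClass_eq (hθ : IsExactAlongPaths θ τ) {α β : PathSpace I G}
    (h : α.treeClass = β.treeClass) : HasSameIntegrals θ α β := by
  have h' := Quot.eqvGen_exact h
  clear h
  induction h' with
  | rel _ _ h => exact h.hasSameIntegrals hθ
  | refl => exact ⟨rfl, fun _ _ => rfl⟩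
  | symm _ _ _ ih => exact ⟨ih.1.symm, fun f hf => (ih.2 f hf).symm⟩
  | trans _ _ _ _ _ ih1 ih2 =>
    exact ⟨ih1.1.trans ih2.1, fun f hf => (ih1.2 f hf).trans (ih2.2 f hf)⟩

end PathIntegral

/-! ### The time transformation is injective -/

section TimeTransform

variable {E : Type*} [NormedAddCommGroup E] [NormedSpace ℝ E] [FiniteDimensional ℝ E]
  {H : Type*} [TopologicalSpace H] {I : ModelWithCorners ℝ E H}
  {G : Type*} [TopologicalSpace G] [ChartedSpace H G] [Group G] [LieGroup I ∞ G]

omit [FiniteDimensional ℝ E] in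
theorem hasDerivAt_toAdd_snd {γ : ℝ → G × Multiplicative ℝ} {t : ℝ}
    (h : MDifferentiableAt 𝓘(ℝ, ℝ) (I.prod 𝓘(ℝ, ℝ)) γ t) :
    HasDerivAt (fun s => Multiplicative.toAdd (γ s).2)
      (timeForm I G (leftVelocity (I.prod 𝓘(ℝ, ℝ)) γ t)) t := by
  have h2 : MDifferentiableAt 𝓘(ℝ, ℝ) (I.prod 𝓘(ℝ, ℝ)) (fun s => (γ t)⁻¹ * γ s) t :=
    MDifferentiableAt.comp t (mdifferentiable_mulLeft (I := I.prod 𝓘(ℝ, ℝ)) _ _) h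
  have h3 := (hasMFDerivAt_snd (I := I) (I' := 𝓘(ℝ, ℝ)) ((γ t)⁻¹ * γ t)).comp t h2.hasMFDerivAt
  have h4 : HasFDerivAt (fun s => -Multiplicative.toAdd (γ t).2 + Multiplicative.toAdd (γ s).2)
      ((ContinuousLinearMap.snd ℝ E ℝ).comp (mfderiv 𝓘(ℝ, ℝ) (I.prod 𝓘(ℝ, ℝ))
        (fun s => (γ t)⁻¹ * γ s) t : ℝ →L[ℝ] E × ℝ)) t := HasMFDerivAt.hasFDerivAt h3
  have h5 := (h4.hasDerivAt.const_add (Multiplicative.toAdd (γ t).2))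
  simp only [add_neg_cancel_left] at h5
  rw [leftVelocity_eq h]
  exact h5

theorem isExactAlongPaths_timeForm :
    IsExactAlongPaths (timeForm I G) fun x : G × Multiplicative ℝ => Multiplicative.toAdd x.2 := by
  intro γ t
  obtain ⟨F, hF, -⟩ := γ.piecewise.exists_finset
  have hc : Continuous fun s => Multiplicative.toAdd (γ.extend s).2 :=
    continuous_toAdd.comp (continuous_snd.comp γ.continuous_extend)
  have hsub : uIcc (0 : ℝ) t ⊆ uIcc 0 1 := by
    rw [uIcc_of_le zero_le_one, uIcc_of_le t.2.1]
    exact Icc_subset_Icc_right t.2.2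
  rw [integral_eq_of_hasDerivAt_off_countable _ _ F.countable_toSet hc.continuousOn (fun s hs => ?_)
    ((γ.intervalIntegrable_linear (timeForm I G)).mono_set hsub)]
  · simp only [PathSpace.extend, IccExtend_val, IccExtend_left]
    rfl
  · refine hasDerivAt_toAdd_snd (hF s ⟨?_, hs.2⟩)
    have h1 := hs.1
    rw [min_eq_left t.2.1, max_eq_right t.2.1] at h1
    exact ⟨h1.1, h1.2.trans_le t.2.2⟩

omit [FiniteDimensional ℝ E] in
theorem pathIntegral_timePath (f : G × Multiplicative ℝ → ℝ) (γ : BasedPathSpace I G) :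
    pathIntegral (timeForm I G) f (timePath γ) =
      ∫ s in (0 : ℝ)..1, f (γ.1.extend s, Multiplicative.ofAdd s) := by
  have h0 : (timePath γ).toFun 0 = 1 := Prod.ext γ.2 rfl
  unfold pathIntegral
  rw [intervalIntegral.integral_of_le zero_le_one, intervalIntegral.integral_of_le zero_le_one,
    integral_Ioc_eq_integral_Ioo, integral_Ioc_eq_integral_Ioo]
  refine integral_congr_ae ((ae_restrict_iff' measurableSet_Ioo).2 ?_)
  filter_upwards [timeForm_leftVelocity_timePath γ] with s hs hst
  rw [hs hst, h0, inv_one, one_mul, mul_one, PathSpace.extend, PathSpace.extend,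
    IccExtend_of_mem _ _ ⟨hst.1.le, hst.2.le⟩, IccExtend_of_mem _ _ ⟨hst.1.le, hst.2.le⟩]
  rfl

theorem timeTransform_injective [T2Space G] :
    Function.Injective (timeTransform (I := I) (G := G)) := by
  intro α β h
  have : IsTopologicalGroup G := topologicalGroup_of_lieGroup I ∞
  let _ := IsTopologicalGroup.rightUniformSpace G
  have hsame := (hasSameIntegrals_of_treeClass_eq isExactAlongPaths_timeForm h).2
  have key : ∀ k : G → ℝ, Continuous k → ∀ t : unitInterval,
      k (α.1.toFun t) = k (β.1.toFun t) := by
    intro k hk t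
    have hα : Continuous fun s => k (α.1.extend s) := hk.comp α.1.continuous_extend
    have hβ : Continuous fun s => k (β.1.extend s) := hk.comp β.1.continuous_extend
    have hz := eqOn_zero_of_moments (v := fun s => k (α.1.extend s) - k (β.1.extend s)) (F := ∅)
      ((hα.sub hβ).intervalIntegrable 0 1) (hα.sub hβ).continuousOn fun m => by
        have hm := hsame (fun x => Multiplicative.toAdd x.2 ^ m * k x.1)
          (((continuous_toAdd.comp continuous_snd).pow m).mul (hk.comp continuous_fst))
        rw [pathIntegral_timePath, pathIntegral_timePath] at hm
        simp only [toAdd_ofAdd] at hm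
        simp only [smul_eq_mul, mul_sub]
        have hiα : Continuous fun s => s ^ m * k (α.1.extend s) := (continuous_pow m).mul hα
        have hiβ : Continuous fun s => s ^ m * k (β.1.extend s) := (continuous_pow m).mul hβ
        exact (intervalIntegral.integral_sub (hiα.intervalIntegrable 0 1)
          (hiβ.intervalIntegrable 0 1)).trans (sub_eq_zero.2 hm)
    rw [Finset.coe_empty, sdiff_empty] at hz
    have hz' := hz.closure (hα.sub hβ) continuous_const
    rw [closure_Ioo zero_ne_one] at hz'
    have ht := sub_eq_zero.1 (hz' t.2)
    simpa [PathSpace.extend] using ht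
  refine Subtype.ext (PathSpace.ext fun t => ?_)
  by_contra hne
  obtain ⟨k, hk, h0, h1⟩ := CompletelyRegularSpace.completely_regular (α.1.toFun t)
    {β.1.toFun t} isClosed_singleton hne
  have h2 := key (fun x => (k x : ℝ)) (continuous_subtype_val.comp hk) t
  rw [h0, h1 (mem_singleton _)] at h2
  simp at h2

end TimeTransform

end LiePath

theorem mainTheorem12
    {E : Type*} [NormedAddCommGroup E] [NormedSpace ℝ E] [FiniteDimensional ℝ E]
    {H : Type*} [TopologicalSpace H] (I : ModelWithCorners ℝ E H) [I.Boundaryless]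
    {G : Type*} [TopologicalSpace G] [ChartedSpace H G] [Group G] [LieGroup I ∞ G] [T2Space G]
    (log : G → GroupLieAlgebra I G) (hlog : ∀ g : G, LiePath.lieExp (log g) = g) :
    Function.Injective (LiePath.timeTransform ∘ LiePath.idInit log :
      LiePath.PathSpace I G →
        LiePath.ReducedPathSpace (I.prod 𝓘(ℝ, ℝ)) (G × Multiplicative ℝ)) ∧
    ∀ (n : ℕ)
      (b : Module.Basis (Fin n) ℝ
        (GroupLieAlgebra (I.prod 𝓘(ℝ, ℝ)) (G × Multiplicative ℝ))),
      Function.Injective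
        (LiePath.signature b ∘ LiePath.timePath ∘ LiePath.idInit log :
          LiePath.PathSpace I G →
            LiePath.TensorSeries
              (GroupLieAlgebra (I.prod 𝓘(ℝ, ℝ)) (G × Multiplicative ℝ))) := by
  refine ⟨LiePath.timeTransform_injective.comp (LiePath.idInit_injective hlog), fun n b => ?_⟩
  exact (LiePath.signature_timePath_injective b).comp (LiePath.idInit_injective hlog)
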